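/- Let $M$ be a smooth manifold of dimension $m\ge 1$ with a volume form $\eta$, let $\pi\colon E\to M$ be a surjective smooth submersion with $n$-dimensional fibres (for instance, a smooth fibre bundle), let $J^1\pi$ be its first-order jet bundle with projections $\pi^1\colon J^1\pi\to E$ and $\bar\pi^1=\pi\circ\pi^1\colon J^1\pi\to M$, and put $\omega=(\bar\pi^1)^*\eta$. Let $L\in C^\infty(J^1\pi)$, and let $\mathcal L=L\,\omega$ be the corresponding Lagrangian density. Let $\mathcal V$ be the vertical endomorphism of $J^1\pi$, in natural coordinates $(x^\alpha,y^A,v^A_\alpha)$ $$\mathcal V=(dy^A-v^A_\alpha dx^\alpha)\otimes\frac{\partial}{\partial v^A_\nu}\otimes\frac{\partial}{\partial x^\nu},$$ and let $\Theta_{\mathcal L}=i(\mathcal V)\mathcal L+\mathcal L$, where $i(\mathcal V)\mathcal L=\frac{\partial L}{\partial v^A_\nu}(dy^A-v^A_\alpha dx^\alpha)\wedge i(\partial/\partial x^\nu)\omega$, and $\Omega_{\mathcal L}=-d\Theta_{\mathcal L}$ be the Poincaré–Cartan $m$- and $(m+1)$-forms. Let $\nabla$ be any Ehresmann connection in the fibration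 $\bar\pi^1\colon J^1\pi\to M$, that is, a smooth horizontal subbundle $\mathrm H(\nabla)$ with $TJ^1\pi=\mathrm H(\nabla)\oplus \mathrm V(\bar\pi^1)$, where $\mathrm V(\bar\pi^1)=\ker T\bar\pi^1$. A $k$-form has bidegree $(p,q)$, $p+q=k$, if it is a section of the summand $\Lambda^p\mathrm H^*(\nabla)\otimes\Lambda^q\mathrm V^*(\bar\pi^1)$ of $\Lambda^kT^*J^1\pi$. Let $\mathcal Y^\nabla_\eta$ be the horizontal lift of the $m$-vector field $\mathcal Z$ on $M$ with $\eta(\mathcal Z)=1$, put $(\gamma_{\mathcal L})^\nabla_\eta=i(\mathcal Y^\nabla_\eta)\Omega_{\mathcal L}$ (for $\mathcal Y^\nabla_\eta=w_1\wedge\dots\wedge w_m$ this is $v\mapsto\Omega_{\mathcal L}(w_1,\dots,w_m,v)$), and let $\Omega^\nabla_{\mathcal L}$ be the sum of all components of $\Omega_{\mathcal L}$ other than the one of bidegree $(m,1)$. Then $(\gamma_{\mathcal L})^\nabla_\eta$ is a smooth $1$-form on $J^1\pi$, $\Omega^\nabla_{\mathcal L}$ is a smooth $(m+1)$-form on $J^1\pi$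 of bidegree $(m-1,2)$ with respect to $\nabla$, and $$\Omega_{\mathcal L}=\omega\wedge(\gamma_{\mathcal L})^\nabla_\eta+\Omega^\nabla_{\mathcal L}.$$ Moreover, $\Omega_{\mathcal L}$ vanishes whenever three of its arguments are tangent to the fibres of $\bar\pi^1$, that is, $i(Z_1)i(Z_2)i(Z_3)\Omega_{\mathcal L}=0$ for all $\bar\pi^1$-vertical vector fields $Z_1,Z_2,Z_3$. -/

import Mathlib

open scoped Manifold ContDiff

noncomputable section

namespace FieldTheory

/-- The model space `ℝᵏ`. -/
abbrev R (k : ℕ) : Type := EuclideanSpace ℝ (Fin k)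

section Jets

variable {m n : ℕ} {M E : Type*} [TopologicalSpace M] [ChartedSpace (R m) M]
  [TopologicalSpace E] [ChartedSpace (R (m + n)) E]

/-- A fibred manifold `π : E → M` with `dim M = m` and fibres of dimension `n`, that is, a
surjective smooth submersion. Every smooth fibre bundle is of this kind. -/
structure FibredManifold (m n : ℕ) (M E : Type*) [TopologicalSpace M] [ChartedSpace (R m) M]
    [TopologicalSpace E] [ChartedSpace (R (m + n)) E] where
  /-- the projection -/
  proj : E → M
  surjective : Function.Surjective proj
  isSubmersion : Manifold.IsSubmersionOfComplement (R n) (𝓡 (m + n)) (𝓡 m) ∞ proj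

/-- The first-order jet bundle `J¹π`. The 1-jet at `x` of a local section `φ` is recorded by the
point `φ x` and the tangent map `T_x φ : T_x M → T_{φ x} E`; the linear maps that occur in this way
are exactly the right inverses of `T_{φ x} π`. -/
structure Jet (π : FibredManifold m n M E) where
  /-- the target `φ x` of the jet -/
  point : E
  /-- the tangent map `T_x φ` -/
  lift : TangentSpace (𝓡 m) (π.proj point) →L[ℝ] TangentSpace (𝓡 (m + n)) point
  mfderiv_comp_lift : (mfderiv (𝓡 (m + n)) (𝓡 m) π.proj point).comp lift =
    ContinuousLinearMap.id ℝ (TangentSpace (𝓡 m) (π.proj point))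

/-- Fibred coordinates `(x^α, y^A)` on an open subset of `E`, over coordinates `x^α` on `M`. -/
structure AdaptedChart (π : FibredManifold m n M E) where
  /-- the coordinates `(x^α, y^A)` -/
  tot : OpenPartialHomeomorph E (R m × R n)
  /-- the coordinates `x^α` -/
  base : OpenPartialHomeomorph M (R m)
  smooth_tot : ContMDiffOn (𝓡 (m + n)) 𝓘(ℝ, R m × R n) ∞ tot tot.source
  smooth_tot_symm : ContMDiffOn 𝓘(ℝ, R m × R n) (𝓡 (m + n)) ∞ tot.symm tot.target
  smooth_base : ContMDiffOn (𝓡 m) (𝓡 m) ∞ base base.source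
  smooth_base_symm : ContMDiffOn (𝓡 m) (𝓡 m) ∞ base.symm base.target
  proj_mem : ∀ e ∈ tot.source, π.proj e ∈ base.source
  fst_tot : ∀ e ∈ tot.source, (tot e).1 = base (π.proj e)

variable {π : FibredManifold m n M E}

theorem FibredManifold.smooth (π : FibredManifold m n M E) :
    ContMDiff (𝓡 (m + n)) (𝓡 m) ∞ π.proj := π.isSubmersion.contMDiff

theorem exists_adaptedChart (π : FibredManifold m n M E) (e : E) :
    ∃ c : AdaptedChart π, e ∈ c.tot.source := by
  have h := π.isSubmersion e
  refine ⟨⟨h.domChart.transHomeomorph h.equiv.toHomeomorph, h.codChart, ?_, ?_, ?_, ?_, ?_, ?_⟩, ?_⟩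
  · exact h.equiv.contDiff.contMDiff.comp_contMDiffOn
      (contMDiffOn_of_mem_maximalAtlas h.domChart_mem_maximalAtlas)
  · exact (contMDiffOn_symm_of_mem_maximalAtlas h.domChart_mem_maximalAtlas).comp
      h.equiv.symm.contDiff.contMDiff.contMDiffOn (fun z hz => hz)
  · exact contMDiffOn_of_mem_maximalAtlas h.codChart_mem_maximalAtlas
  · exact contMDiffOn_symm_of_mem_maximalAtlas h.codChart_mem_maximalAtlas
  · intro e he
    exact h.source_subset_preimage_source he
  · intro e he
    have he' : e ∈ h.domChart.source := he
    have ht : h.domChart e ∈ (h.domChart.extend (𝓡 (m + n))).target := by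
      simpa [OpenPartialHomeomorph.extend_target] using h.domChart.map_source he'
    have := h.writtenInCharts ht
    simpa [h.domChart.left_inv he'] using this.symm
  · exact h.mem_domChart_source

namespace AdaptedChart

variable (c : AdaptedChart π)

theorem mdiff_tot {e : E} (he : e ∈ c.tot.source) :
    MDifferentiableAt (𝓡 (m + n)) 𝓘(ℝ, R m × R n) c.tot e :=
  (c.smooth_tot.contMDiffAt (c.tot.open_source.mem_nhds he)).mdifferentiableAt (by simp)

theorem mdiff_tot_symm {z : R m × R n} (hz : z ∈ c.tot.target) :
    MDifferentiableAt 𝓘(ℝ, R m × R n) (𝓡 (m + n)) c.tot.symm z :=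
  (c.smooth_tot_symm.contMDiffAt (c.tot.open_target.mem_nhds hz)).mdifferentiableAt (by simp)

theorem mdiff_base {x : M} (hx : x ∈ c.base.source) :
    MDifferentiableAt (𝓡 m) (𝓡 m) c.base x :=
  (c.smooth_base.contMDiffAt (c.base.open_source.mem_nhds hx)).mdifferentiableAt (by simp)

theorem mdiff_base_symm {z : R m} (hz : z ∈ c.base.target) :
    MDifferentiableAt (𝓡 m) (𝓡 m) c.base.symm z :=
  (c.smooth_base_symm.contMDiffAt (c.base.open_target.mem_nhds hz)).mdifferentiableAt (by simp)

theorem mdiff_proj (e : E) : MDifferentiableAt (𝓡 (m + n)) (𝓡 m) π.proj e :=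
  (π.smooth e).mdifferentiableAt (by simp)

/-- The differential of the fibred coordinates at `e`. -/
def dTot (e : E) : R (m + n) →L[ℝ] R m × R n := mfderiv (𝓡 (m + n)) 𝓘(ℝ, R m × R n) c.tot e

/-- The differential of the inverse of the fibred coordinates at `z`. -/
def dTotSymm (z : R m × R n) : R m × R n →L[ℝ] R (m + n) :=
  mfderiv 𝓘(ℝ, R m × R n) (𝓡 (m + n)) c.tot.symm z

/-- The differential of the base coordinates at `x`. -/
def dBase (x : M) : R m →L[ℝ] R m := mfderiv (𝓡 m) (𝓡 m) c.base x

/-- The differential of the inverse of the base coordinates at `z`. -/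
def dBaseSymm (z : R m) : R m →L[ℝ] R m := mfderiv (𝓡 m) (𝓡 m) c.base.symm z

/-- The differential of the projection `π` at `e`. -/
def dProj (π : FibredManifold m n M E) (e : E) : R (m + n) →L[ℝ] R m :=
  mfderiv (𝓡 (m + n)) (𝓡 m) π.proj e

theorem base_mem_target {e : E} (he : e ∈ c.tot.source) :
    c.base (π.proj e) ∈ c.base.target := c.base.map_source (c.proj_mem e he)

theorem dTotSymm_comp_dTot {e : E} (he : e ∈ c.tot.source) :
    (c.dTotSymm (c.tot e)).comp (c.dTot e) = .id ℝ _ := by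
  have h := mfderiv_comp e (c.mdiff_tot_symm (c.tot.map_source he)) (c.mdiff_tot he)
  have h2 : (c.tot.symm ∘ c.tot) =ᶠ[nhds e] id :=
    Filter.eventuallyEq_of_mem (c.tot.open_source.mem_nhds he) fun x hx => c.tot.left_inv hx
  exact h.symm.trans (h2.mfderiv_eq.trans mfderiv_id)

theorem dTot_comp_dTotSymm {z : R m × R n} (hz : z ∈ c.tot.target) :
    (c.dTot (c.tot.symm z)).comp (c.dTotSymm z) = .id ℝ _ := by
  have h := mfderiv_comp z (c.mdiff_tot (c.tot.map_target hz)) (c.mdiff_tot_symm hz)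
  have h2 : (c.tot ∘ c.tot.symm) =ᶠ[nhds z] id :=
    Filter.eventuallyEq_of_mem (c.tot.open_target.mem_nhds hz) fun x hx => c.tot.right_inv hx
  exact h.symm.trans (h2.mfderiv_eq.trans mfderiv_id)

theorem dBaseSymm_comp_dBase {x : M} (hx : x ∈ c.base.source) :
    (c.dBaseSymm (c.base x)).comp (c.dBase x) = .id ℝ _ := by
  have h := mfderiv_comp x (c.mdiff_base_symm (c.base.map_source hx)) (c.mdiff_base hx)
  have h2 : (c.base.symm ∘ c.base) =ᶠ[nhds x] id :=
    Filter.eventuallyEq_of_mem (c.base.open_source.mem_nhds hx) fun x hx => c.base.left_inv hx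
  exact h.symm.trans (h2.mfderiv_eq.trans mfderiv_id)

theorem dBase_comp_dBaseSymm {z : R m} (hz : z ∈ c.base.target) :
    (c.dBase (c.base.symm z)).comp (c.dBaseSymm z) = .id ℝ _ := by
  have h := mfderiv_comp z (c.mdiff_base (c.base.map_target hz)) (c.mdiff_base_symm hz)
  have h2 : (c.base ∘ c.base.symm) =ᶠ[nhds z] id :=
    Filter.eventuallyEq_of_mem (c.base.open_target.mem_nhds hz) fun x hx => c.base.right_inv hx
  exact h.symm.trans (h2.mfderiv_eq.trans mfderiv_id)

theorem fst_comp_dTot {e : E} (he : e ∈ c.tot.source) :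
    (ContinuousLinearMap.fst ℝ (R m) (R n)).comp (c.dTot e) =
      (c.dBase (π.proj e)).comp (dProj π e) := by
  have hf : HasMFDerivAt 𝓘(ℝ, R m × R n) (𝓡 m) (Prod.fst : R m × R n → R m) (c.tot e)
      (ContinuousLinearMap.fst ℝ (R m) (R n)) := (hasFDerivAt_fst (𝕜 := ℝ)).hasMFDerivAt
  have h1 := hf.comp e (c.mdiff_tot he).hasMFDerivAt
  have h2 := (c.mdiff_base (c.proj_mem e he)).hasMFDerivAt.comp e (mdiff_proj e).hasMFDerivAt
  have h3 : (Prod.fst ∘ c.tot : E → R m) =ᶠ[nhds e] c.base ∘ π.proj :=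
    Filter.eventuallyEq_of_mem (c.tot.open_source.mem_nhds he) fun x hx => c.fst_tot x hx
  exact hasMFDerivAt_unique (h1.congr_of_eventuallyEq h3.symm) h2

end AdaptedChart

/-- The tangent map of a 1-jet, read in the model spaces. -/
def Jet.tangent (j : Jet π) : R m →L[ℝ] R (m + n) := j.lift

theorem Jet.dProj_comp_tangent (j : Jet π) :
    (AdaptedChart.dProj π j.point).comp j.tangent = .id ℝ _ := j.mfderiv_comp_lift

theorem Jet.ext' {j j' : Jet π} (h : j.point = j'.point) (h' : j.tangent = j'.tangent) :
    j = j' := by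
  obtain ⟨p, l, hl⟩ := j
  obtain ⟨p', l', hl'⟩ := j'
  obtain rfl : p = p' := h
  obtain rfl : l = l' := h'
  rfl

/-- The model space of `J¹π`: the natural coordinates are `((x^α, y^A), v^A_α)`. -/
abbrev JetModel (m n : ℕ) : Type := (R m × R n) × (R m →L[ℝ] R n)

namespace AdaptedChart

variable (c : AdaptedChart π)

/-- The coordinates `v^A_α` of a 1-jet: the matrix of partial derivatives of the section. -/
def velocity (j : Jet π) : R m →L[ℝ] R n :=
  (ContinuousLinearMap.snd ℝ (R m) (R n)).comp
    ((c.dTot j.point).comp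
      (j.tangent.comp (c.dBaseSymm (c.base (π.proj j.point)))))

theorem dTot_comp_tangent (j : Jet π) (hj : j.point ∈ c.tot.source) :
    (c.dTot j.point).comp j.tangent =
      ((ContinuousLinearMap.id ℝ (R m)).prod (c.velocity j)).comp (c.dBase (π.proj j.point)) := by
  have h1 := c.fst_comp_dTot hj
  have h2 := j.dProj_comp_tangent
  have h3 := c.dBaseSymm_comp_dBase (c.proj_mem _ hj)
  refine ContinuousLinearMap.ext fun (u : R m) => ?_
  have e1 := DFunLike.congr_fun h1 (j.tangent u)
  have e2 := DFunLike.congr_fun h2 u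
  have e3 := DFunLike.congr_fun h3 u
  simp only [ContinuousLinearMap.comp_apply, ContinuousLinearMap.id_apply,
    ContinuousLinearMap.coe_fst'] at e1 e2 e3
  refine Prod.ext ?_ ?_
  · simp [e1, e2]
  · simp [velocity, e3]

/-- The 1-jet with given natural coordinates. -/
def mkJet (z : R m × R n) (v : R m →L[ℝ] R n) (hz : z ∈ c.tot.target) : Jet π where
  point := c.tot.symm z
  lift := ((c.dTotSymm z).comp (((ContinuousLinearMap.id ℝ (R m)).prod v).comp
    (c.dBase (π.proj (c.tot.symm z)))) : R m →L[ℝ] R (m + n))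
  mfderiv_comp_lift := by
    have hs := c.tot.map_target hz
    have h1 := c.fst_comp_dTot hs
    have h2 := c.dTot_comp_dTotSymm hz
    have h3 := c.dBaseSymm_comp_dBase (c.proj_mem _ hs)
    change (dProj π (c.tot.symm z)).comp _ = ContinuousLinearMap.id ℝ (R m)
    refine ContinuousLinearMap.ext fun (u : R m) => ?_
    have e2 := DFunLike.congr_fun h2 (c.dBase (π.proj (c.tot.symm z)) u,
      v (c.dBase (π.proj (c.tot.symm z)) u))
    have e1 := DFunLike.congr_fun h1 (c.dTotSymm z (c.dBase (π.proj (c.tot.symm z)) u,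
      v (c.dBase (π.proj (c.tot.symm z)) u)))
    have e3 := fun w => DFunLike.congr_fun h3 w
    simp only [ContinuousLinearMap.comp_apply, ContinuousLinearMap.id_apply,
      ContinuousLinearMap.coe_fst'] at e1 e2 e3
    rw [e2] at e1
    have := congrArg (c.dBaseSymm (c.base (π.proj (c.tot.symm z)))) e1
    rw [e3, e3] at this
    simpa using this.symm

theorem mkJet_tangent (z : R m × R n) (v : R m →L[ℝ] R n) (hz : z ∈ c.tot.target) :
    (c.mkJet z v hz).tangent = (c.dTotSymm z).comp (((ContinuousLinearMap.id ℝ (R m)).prod v).comp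
      (c.dBase (π.proj (c.tot.symm z)))) := rfl

open Classical in
/-- The natural chart `(x^α, y^A, v^A_α)` of `J¹π` induced by fibred coordinates `c`. The jet `j₀`
only serves as the value of the inverse outside of the target. -/
def jetChart (j₀ : Jet π) : PartialEquiv (Jet π) (JetModel m n) where
  toFun j := (c.tot j.point, c.velocity j)
  invFun p := if hp : p.1 ∈ c.tot.target then c.mkJet p.1 p.2 hp else j₀
  source := {j | j.point ∈ c.tot.source}
  target := {p | p.1 ∈ c.tot.target}
  map_source' j hj := c.tot.map_source hj
  map_target' p hp := by
    have hp' : p.1 ∈ c.tot.target := hp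
    simp [hp', mkJet, c.tot.map_target hp']
  left_inv' j hj := by
    have hj' : c.tot j.point ∈ c.tot.target := c.tot.map_source hj
    have hs : c.tot.symm (c.tot j.point) = j.point := c.tot.left_inv hj
    simp only [hj', dite_true]
    refine Jet.ext' hs ?_
    have h1 := c.dTot_comp_tangent j hj
    have h2 := c.dTotSymm_comp_dTot hj
    have hp : ∀ e : E, e = j.point → (c.dTotSymm (c.tot j.point)).comp
        (((ContinuousLinearMap.id ℝ (R m)).prod (c.velocity j)).comp (c.dBase (π.proj e))) =
        j.tangent := by
      rintro e rfl
      rw [← h1, ← ContinuousLinearMap.comp_assoc, h2, ContinuousLinearMap.id_comp]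
    exact hp _ hs
  right_inv' p hp := by
    obtain ⟨z, v⟩ := p
    have hp' : z ∈ c.tot.target := hp
    have hs := c.tot.map_target hp'
    simp only [hp', dite_true]
    refine Prod.ext (c.tot.right_inv hp') ?_
    have h2 := c.dTot_comp_dTotSymm hp'
    have hb : c.base (π.proj (c.tot.symm z)) ∈ c.base.target := c.base_mem_target hs
    have h3 := c.dBase_comp_dBaseSymm hb
    rw [c.base.left_inv (c.proj_mem _ hs)] at h3
    refine ContinuousLinearMap.ext fun (u : R m) => ?_
    have e3 := DFunLike.congr_fun h3 u
    have e2 := fun w => DFunLike.congr_fun h2 w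
    simp only [ContinuousLinearMap.comp_apply, ContinuousLinearMap.id_apply] at e2 e3
    simp only [velocity, mkJet_tangent, ContinuousLinearMap.comp_apply]
    simp [mkJet, e2, e3]

theorem jetChart_transition_source (c c' : AdaptedChart π) (j₀ j₀' : Jet π) :
    ((c.jetChart j₀).symm.trans (c'.jetChart j₀')).source =
      (c.tot.symm.trans c'.tot).source ×ˢ Set.univ := by
  ext ⟨z, v⟩
  by_cases hz : z ∈ c.tot.target <;>
    simp [PartialEquiv.trans_source, jetChart, hz, mkJet]

theorem isOpen_jetChart_transition_source (c c' : AdaptedChart π) (j₀ j₀' : Jet π) :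
    IsOpen ((c.jetChart j₀).symm.trans (c'.jetChart j₀')).source := by
  rw [jetChart_transition_source]
  exact (c.tot.symm.trans c'.tot).open_source.prod isOpen_univ

theorem contDiffOn_tot (c c' : AdaptedChart π) :
    ContDiffOn ℝ ∞ (c'.tot ∘ c.tot.symm) (c.tot.symm.trans c'.tot).source := by
  rw [← contMDiffOn_iff_contDiffOn]
  exact c'.smooth_tot.comp (c.smooth_tot_symm.mono fun z hz => hz.1) fun z hz => hz.2

theorem contDiffOn_base (c c' : AdaptedChart π) :
    ContDiffOn ℝ ∞ (c'.base ∘ c.base.symm) (c.base.symm.trans c'.base).source := by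
  rw [← contMDiffOn_iff_contDiffOn]
  exact c'.smooth_base.comp (c.smooth_base_symm.mono fun z hz => hz.1) fun z hz => hz.2

/-- The velocity coordinates transform affinely under a change of fibred coordinates. -/
theorem velocity_mkJet (c c' : AdaptedChart π) (z : R m × R n) (v : R m →L[ℝ] R n)
    (hz : z ∈ c.tot.target) (hz' : c.tot.symm z ∈ c'.tot.source) :
    c'.velocity (c.mkJet z v hz) = (ContinuousLinearMap.snd ℝ (R m) (R n)).comp
      ((fderiv ℝ (c'.tot ∘ c.tot.symm) z).comp (((ContinuousLinearMap.id ℝ (R m)).prod v).comp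
        (fderiv ℝ (c.base ∘ c'.base.symm) (((c'.tot ∘ c.tot.symm) z).1)))) := by
  have hs := c.tot.map_target hz
  have h1 : fderiv ℝ (c'.tot ∘ c.tot.symm) z = (c'.dTot (c.tot.symm z)).comp (c.dTotSymm z) := by
    rw [← mfderiv_eq_fderiv]
    exact mfderiv_comp z (c'.mdiff_tot hz') (c.mdiff_tot_symm hz)
  have hx : π.proj (c.tot.symm z) ∈ c'.base.source := c'.proj_mem _ hz'
  have hx' : c'.base.symm (c'.base (π.proj (c.tot.symm z))) = π.proj (c.tot.symm z) :=
    c'.base.left_inv hx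
  have h2 : fderiv ℝ (c.base ∘ c'.base.symm) (c'.base (π.proj (c.tot.symm z))) =
      (c.dBase (π.proj (c.tot.symm z))).comp
        (c'.dBaseSymm (c'.base (π.proj (c.tot.symm z)))) := by
    rw [← mfderiv_eq_fderiv]
    have := mfderiv_comp (I := 𝓡 m) (I' := 𝓡 m) (I'' := 𝓡 m)
      (c'.base (π.proj (c.tot.symm z))) (g := c.base) (f := c'.base.symm)
      (by rw [hx']; exact c.mdiff_base (c.proj_mem _ hs))
      (c'.mdiff_base_symm (c'.base.map_source hx))
    rw [hx'] at this
    exact this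
  have h3 : ((c'.tot ∘ c.tot.symm) z).1 = c'.base (π.proj (c.tot.symm z)) := c'.fst_tot _ hz'
  rw [h3, h1, h2]
  rfl

theorem jetChart_transition (c c' : AdaptedChart π) (j₀ j₀' : Jet π) :
    ContDiffOn ℝ ∞ ((c.jetChart j₀).symm.trans (c'.jetChart j₀'))
      ((c.jetChart j₀).symm.trans (c'.jetChart j₀')).source := by
  rw [jetChart_transition_source]
  set S := (c.tot.symm.trans c'.tot).source with hS
  have hT := contDiffOn_tot c c'
  have hSo : IsOpen S := (c.tot.symm.trans c'.tot).open_source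
  have hB := contDiffOn_base c' c
  have hBo : IsOpen (c'.base.symm.trans c.base).source := (c'.base.symm.trans c.base).open_source
  have hmaps : ∀ z ∈ S, ((c'.tot ∘ c.tot.symm) z).1 ∈ (c'.base.symm.trans c.base).source := by
    intro z hz
    have hz1 : z ∈ c.tot.target := hz.1
    have hz2 : c.tot.symm z ∈ c'.tot.source := hz.2
    have h3 : ((c'.tot ∘ c.tot.symm) z).1 = c'.base (π.proj (c.tot.symm z)) := c'.fst_tot _ hz2
    rw [h3]
    refine ⟨c'.base_mem_target hz2, ?_⟩
    change c'.base.symm _ ∈ c.base.source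
    rw [c'.base.left_inv (c'.proj_mem _ hz2)]
    exact c.proj_mem _ (c.tot.map_target hz1)
  have hfst : ContDiffOn ℝ ∞ (fun p : JetModel m n => p.1) (S ×ˢ Set.univ) :=
    contDiff_fst.contDiffOn
  have hsnd : ContDiffOn ℝ ∞ (fun p : JetModel m n => p.2) (S ×ˢ Set.univ) :=
    contDiff_snd.contDiffOn
  have hT1 : ContDiffOn ℝ ∞ (fun p : JetModel m n => (c'.tot ∘ c.tot.symm) p.1)
      (S ×ˢ Set.univ) := hT.comp hfst fun p hp => hp.1
  have hDT : ContDiffOn ℝ ∞ (fun p : JetModel m n => fderiv ℝ (c'.tot ∘ c.tot.symm) p.1)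
      (S ×ˢ Set.univ) :=
    (hT.fderiv_of_isOpen hSo (by simp)).comp hfst fun p hp => hp.1
  have hDB : ContDiffOn ℝ ∞ (fun p : JetModel m n =>
      fderiv ℝ (c.base ∘ c'.base.symm) (((c'.tot ∘ c.tot.symm) p.1).1)) (S ×ˢ Set.univ) :=
    (hB.fderiv_of_isOpen hBo (by simp)).comp (contDiff_fst.comp_contDiffOn hT1)
      fun p hp => hmaps p.1 hp.1
  have hid : ContDiffOn ℝ ∞ (fun p : JetModel m n => (ContinuousLinearMap.id ℝ (R m)).prod p.2)
      (S ×ˢ Set.univ) := by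
    have : (fun p : JetModel m n => (ContinuousLinearMap.id ℝ (R m)).prod p.2) =
        fun p => (ContinuousLinearMap.inl ℝ (R m) (R n)).comp (ContinuousLinearMap.id ℝ (R m)) +
          (ContinuousLinearMap.inr ℝ (R m) (R n)).comp p.2 := by
      funext p
      ext u <;> simp
    rw [this]
    exact contDiffOn_const.add (contDiffOn_const.clm_comp hsnd)
  refine (hT1.prodMk (contDiffOn_const.clm_comp
    (hDT.clm_comp (hid.clm_comp hDB)))).congr (f := fun p : JetModel m n =>
      ((c'.tot ∘ c.tot.symm) p.1, (ContinuousLinearMap.snd ℝ (R m) (R n)).comp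
      ((fderiv ℝ (c'.tot ∘ c.tot.symm) p.1).comp
        (((ContinuousLinearMap.id ℝ (R m)).prod p.2).comp
          (fderiv ℝ (c.base ∘ c'.base.symm) (((c'.tot ∘ c.tot.symm) p.1).1)))))) ?_
  rintro ⟨z, v⟩ hp
  have hz : z ∈ c.tot.target := hp.1.1
  have hz' : c.tot.symm z ∈ c'.tot.source := hp.1.2
  refine Prod.ext ?_ ?_
  · simp [jetChart, hz, mkJet]
  · simpa [jetChart, hz] using velocity_mkJet c c' z v hz hz'

end AdaptedChart

/-- The natural charts of `J¹π`. -/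
def jetCore (π : FibredManifold m n M E) : ChartedSpaceCore (JetModel m n) (Jet π) where
  atlas := {f | ∃ (c : AdaptedChart π) (j₀ : Jet π), f = c.jetChart j₀}
  chartAt j := (exists_adaptedChart π j.point).choose.jetChart j
  mem_chart_source j := (exists_adaptedChart π j.point).choose_spec
  chart_mem_atlas j := ⟨_, _, rfl⟩
  open_source := by
    rintro _ _ ⟨c, j₀, rfl⟩ ⟨c', j₀', rfl⟩
    exact AdaptedChart.isOpen_jetChart_transition_source c c' j₀ j₀'
  continuousOn_toFun := by
    rintro _ _ ⟨c, j₀, rfl⟩ ⟨c', j₀', rfl⟩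
    exact (AdaptedChart.jetChart_transition c c' j₀ j₀').continuousOn

instance : TopologicalSpace (Jet π) := (jetCore π).toTopologicalSpace

instance : ChartedSpace (JetModel m n) (Jet π) := (jetCore π).toChartedSpace

instance : IsManifold 𝓘(ℝ, JetModel m n) ∞ (Jet π) := by
  refine isManifold_of_contDiffOn _ _ _ ?_
  rintro e e' he he'
  have key : ∀ e ∈ atlas (JetModel m n) (Jet π), ∃ (c : AdaptedChart π) (j₀ : Jet π),
      e.toPartialEquiv = c.jetChart j₀ := by
    intro e he
    obtain ⟨f, hf⟩ := Set.mem_iUnion.1 he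
    obtain ⟨⟨c, j₀, rfl⟩, rfl⟩ := Set.mem_iUnion.1 hf
    exact ⟨c, j₀, rfl⟩
  obtain ⟨c, j₀, h⟩ := key e he
  obtain ⟨c', j₀', h'⟩ := key e' he'
  have := AdaptedChart.jetChart_transition c c' j₀ j₀'
  rw [← h, ← h'] at this
  simpa using this

end Jets

section Forms

variable {V W : Type*} [NormedAddCommGroup V] [NormedSpace ℝ V]
  [NormedAddCommGroup W] [NormedSpace ℝ W]
  {N Q : Type*} [TopologicalSpace N] [ChartedSpace V N] [TopologicalSpace Q] [ChartedSpace W Q]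
  {k : ℕ}

instance [FiniteDimensional ℝ V] (y : N) : FiniteDimensional ℝ (TangentSpace 𝓘(ℝ, V) y) :=
  inferInstanceAs (FiniteDimensional ℝ V)

instance (y : N) : T2Space (TangentSpace 𝓘(ℝ, V) y) := inferInstanceAs (T2Space V)

/-- Fields of alternating `k`-forms on a manifold `N` modelled on `V`. The differential `k`-forms
are those that satisfy `DForm.IsSmooth`. -/
abbrev DForm (V : Type*) [NormedAddCommGroup V] [NormedSpace ℝ V] (N : Type*)
    [TopologicalSpace N] [ChartedSpace V N] (k : ℕ) : Type _ :=
  (y : N) → TangentSpace 𝓘(ℝ, V) y [⋀^Fin k]→L[ℝ] ℝ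

namespace DForm

/-- The expression of a form in the preferred chart at `y₀`: its pullback by the inverse of the
chart. -/
def inChart (α : DForm V N k) (y₀ : N) (z : V) : V [⋀^Fin k]→L[ℝ] ℝ :=
  (α ((chartAt V y₀).symm z)).compContinuousLinearMap
    (mfderiv 𝓘(ℝ, V) 𝓘(ℝ, V) (chartAt V y₀).symm z)

/-- A form is smooth if all its expressions in charts are smooth. -/
def IsSmooth (α : DForm V N k) : Prop :=
  ∀ y₀ : N, ContDiffOn ℝ ∞ (α.inChart y₀) (chartAt V y₀).target

/-- The exterior derivative, computed at each point `y` in the preferred chart at `y`. -/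
def extDeriv (α : DForm V N k) : DForm V N (k + 1) := fun y =>
  (_root_.extDeriv (α.inChart y) (chartAt V y y)).compContinuousLinearMap
    (mfderiv 𝓘(ℝ, V) 𝓘(ℝ, V) (chartAt V y) y)

/-- The pullback of a form. -/
def pullback (f : N → Q) (α : DForm W Q k) : DForm V N k := fun y =>
  (α (f y)).compContinuousLinearMap (mfderiv 𝓘(ℝ, V) 𝓘(ℝ, W) f y)

end DForm

/-- The wedge product of alternating forms,
`(α ∧ β)(v₁, …, v_{k+l}) = ∑ sgn(σ) α(v_{σ 1}, …, v_{σ k}) β(v_{σ (k+1)}, …, v_{σ (k+l)})`,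
the sum being over the `(k, l)`-shuffles `σ`. -/
def wedge {T : Type*} [AddCommGroup T] [Module ℝ T] {k l : ℕ}
    (α : T [⋀^Fin k]→ₗ[ℝ] ℝ) (β : T [⋀^Fin l]→ₗ[ℝ] ℝ) : T [⋀^Fin (k + l)]→ₗ[ℝ] ℝ :=
  ((LinearMap.mul' ℝ ℝ).compAlternatingMap (α.domCoprod β)).domDomCongr finSumFinEquiv

section Mixed

variable {T T' : Type*} [AddCommGroup T] [Module ℝ T] [TopologicalSpace T]
  [AddCommGroup T'] [Module ℝ T'] [TopologicalSpace T']

/-- For an alternating `k`-form `f` on `T'` and linear maps `A B : T → T'`, the `k`-form on `T`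
`(v₁, …, v_k) ↦ ∑_S f(w₁, …, w_k)`, with `wᵢ = A vᵢ` for `i ∈ S` and `wᵢ = B vᵢ` for `i ∉ S`,
the sum being over all subsets `S` of the set of indices with exactly `p` elements. -/
def mixedPart (p : ℕ) (f : T' [⋀^Fin k]→L[ℝ] ℝ) (A B : T →L[ℝ] T') : T [⋀^Fin k]→L[ℝ] ℝ where
  toContinuousMultilinearMap := ∑ S ∈ Finset.powersetCard p (Finset.univ : Finset (Fin k)),
    f.toContinuousMultilinearMap.compContinuousLinearMap fun i => if i ∈ S then A else B
  map_eq_zero_of_eq' := by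
    intro v i j hv hij
    have hσ : ∀ a, v (Equiv.swap i j a) = v a := by
      intro a
      rw [Equiv.swap_apply_def]
      split_ifs with h h'
      · rw [h, hv]
      · rw [h', hv]
      · rfl
    let g : Finset (Fin k) → Fin k → T' := fun S a => if a ∈ S then A (v a) else B (v a)
    have hg : ∀ S, g (S.map (Equiv.swap i j).toEmbedding) = g S ∘ Equiv.swap i j := by
      intro S
      funext a
      simp only [g, Function.comp_apply, hσ, Finset.mem_map_equiv, Equiv.symm_swap]
    have hsum : ∑ S ∈ Finset.powersetCard p (Finset.univ : Finset (Fin k)), f (g S) = 0 := by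
      refine Finset.sum_involution (fun S _ => S.map (Equiv.swap i j).toEmbedding) ?_ ?_ ?_ ?_
      · intro S _
        rw [hg]
        have := f.toAlternatingMap.map_swap (g S) hij
        change f (g S ∘ Equiv.swap i j) = - f (g S) at this
        rw [this, add_neg_cancel]
      · intro S _ hne heq
        apply hne
        refine f.map_eq_zero_of_eq (g S) (i := i) (j := j) ?_ hij
        have := congrFun (hg S) i
        rw [heq] at this
        simpa using this
      · intro S hS
        simpa [Finset.mem_powersetCard] using hS
      · intro S _
        ext a
        simp [Finset.mem_map_equiv]
    have happ : ∀ S : Finset (Fin k), (f.toContinuousMultilinearMap.compContinuousLinearMap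
        fun i => if i ∈ S then A else B) v = f (g S) := by
      intro S
      rw [ContinuousMultilinearMap.compContinuousLinearMap_apply]
      change f _ = _
      congr 1
      funext a
      by_cases h : a ∈ S <;> simp [g, h]
    change (∑ S ∈ Finset.powersetCard p (Finset.univ : Finset (Fin k)),
      f.toContinuousMultilinearMap.compContinuousLinearMap fun i => if i ∈ S then A else B) v = 0
    rw [_root_.sum_apply, ← hsum]
    exact Finset.sum_congr rfl fun S _ => happ S

theorem mixedPart_apply (p : ℕ) (f : T' [⋀^Fin k]→L[ℝ] ℝ) (A B : T →L[ℝ] T') (v : Fin k → T) :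
    mixedPart p f A B v = ∑ S ∈ Finset.powersetCard p (Finset.univ : Finset (Fin k)),
      f fun i => if i ∈ S then A (v i) else B (v i) := by
  change (∑ S ∈ Finset.powersetCard p (Finset.univ : Finset (Fin k)),
      f.toContinuousMultilinearMap.compContinuousLinearMap fun i => if i ∈ S then A else B) v = _
  rw [_root_.sum_apply]
  refine Finset.sum_congr rfl fun S _ => ?_
  rw [ContinuousMultilinearMap.compContinuousLinearMap_apply]
  change f _ = _
  congr 1
  funext a
  by_cases h : a ∈ S <;> simp [h]

end Mixed

/-- The contraction `i(X)α` of an `(m+1)`-form with an `m`-vector: the 1-form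
`v ↦ α(X ∧ v)`, which for `X = w₁ ∧ ⋯ ∧ w_m` is `v ↦ α(w₁, …, w_m, v) = (-1)^m α(v, w₁, …, w_m)`. -/
def contract {m : ℕ} {T : Type*} [AddCommGroup T] [Module ℝ T] [TopologicalSpace T]
    [IsTopologicalAddGroup T] [ContinuousSMul ℝ T] [T2Space T] [FiniteDimensional ℝ T]
    (X : ⋀[ℝ]^m T) (α : T [⋀^Fin (m + 1)]→L[ℝ] ℝ) : T [⋀^Fin 1]→L[ℝ] ℝ :=
  ContinuousAlternatingMap.ofSubsingleton ℝ T ℝ 0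
    (LinearMap.toContinuousLinearMap (((-1 : ℝ) ^ m) •
      (LinearMap.applyₗ X ∘ₗ exteriorPower.alternatingMapLinearEquiv.toLinearMap ∘ₗ
        α.toAlternatingMap.curryLeft)))

/-- A volume form: a smooth nowhere vanishing form of top degree. -/
structure IsVolumeForm {m : ℕ} {M : Type*} [TopologicalSpace M] [ChartedSpace (R m) M]
    (η : DForm (R m) M m) : Prop where
  smooth : η.IsSmooth
  ne_zero : ∀ x, η x ≠ 0

/-- The coordinate basis of `T_x M` in the preferred chart at `x`. -/
def tangentBasis {m : ℕ} {M : Type*} [TopologicalSpace M] [ChartedSpace (R m) M] (x : M)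
    (μ : Fin m) : TangentSpace (𝓡 m) x :=
  (EuclideanSpace.single μ 1 : R m)

/-- The dual basis of `tangentBasis`. -/
def cotangentBasis {m : ℕ} {M : Type*} [TopologicalSpace M] [ChartedSpace (R m) M] (x : M)
    (μ : Fin m) : TangentSpace (𝓡 m) x →L[ℝ] ℝ :=
  (EuclideanSpace.proj μ : R m →L[ℝ] ℝ)

/-- The `m`-vector `Z` at `x` with `η(Z) = 1`. -/
def unitMultivector {m : ℕ} {M : Type*} [TopologicalSpace M] [ChartedSpace (R m) M]
    (η : DForm (R m) M m) (x : M) : ⋀[ℝ]^m (TangentSpace (𝓡 m) x) :=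
  (η x (tangentBasis x))⁻¹ • exteriorPower.ιMulti ℝ m (tangentBasis x)

/-- An Ehresmann connection in a fibration `κ : N → Q`, given by its horizontal lifts
`T_{κ y} Q → T_y N`, depending smoothly on `y`; their images are the horizontal subspaces. -/
structure EhresmannConnection [IsManifold 𝓘(ℝ, V) ∞ N] [IsManifold 𝓘(ℝ, W) ∞ Q]
    (κ : N → Q) where
  /-- the horizontal lift at `y` -/
  lift : (y : N) → TangentSpace 𝓘(ℝ, W) (κ y) →L[ℝ] TangentSpace 𝓘(ℝ, V) y
  mfderiv_comp_lift : ∀ y, (mfderiv 𝓘(ℝ, V) 𝓘(ℝ, W) κ y).comp (lift y) =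
    ContinuousLinearMap.id ℝ (TangentSpace 𝓘(ℝ, W) (κ y))
  smooth : ∀ y₀, ContMDiffAt 𝓘(ℝ, V) 𝓘(ℝ, W →L[ℝ] V) ∞
    (inTangentCoordinates 𝓘(ℝ, W) 𝓘(ℝ, V) κ id lift y₀) y₀

namespace EhresmannConnection

variable [IsManifold 𝓘(ℝ, V) ∞ N] [IsManifold 𝓘(ℝ, W) ∞ Q] {κ : N → Q}

/-- The projection of `T_y N = H_y ⊕ V_y` onto the horizontal subspace. -/
def horProj (C : EhresmannConnection (V := V) (W := W) κ) (y : N) :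
    TangentSpace 𝓘(ℝ, V) y →L[ℝ] TangentSpace 𝓘(ℝ, V) y :=
  (C.lift y).comp (mfderiv 𝓘(ℝ, V) 𝓘(ℝ, W) κ y)

/-- The projection of `T_y N = H_y ⊕ V_y` onto the vertical subspace. -/
def verProj (C : EhresmannConnection (V := V) (W := W) κ) (y : N) :
    TangentSpace 𝓘(ℝ, V) y →L[ℝ] TangentSpace 𝓘(ℝ, V) y :=
  ContinuousLinearMap.id ℝ _ - C.horProj y

/-- The component of bidegree `(p, k - p)` of a `k`-form `α`, that is, its component in
`Λᵖ H^* ⊗ Λ^{k-p} V^*`. By multilinearity, `α` is the sum of these components. -/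
def bidegreePart (C : EhresmannConnection (V := V) (W := W) κ) (p : ℕ) (α : DForm V N k) :
    DForm V N k := fun y => mixedPart p (α y) (C.horProj y) (C.verProj y)

/-- A `k`-form has bidegree `(p, q)`, with `p + q = k`, if it equals its component of this
bidegree. -/
def HasBidegree (C : EhresmannConnection (V := V) (W := W) κ) (p q : ℕ) (α : DForm V N k) : Prop :=
  p + q = k ∧ C.bidegreePart p α = α

/-- The `m`-vector field associated with a connection and a volume form: the horizontal lift of
the `m`-vector `Z` with `η(Z) = 1`. -/
def multivector {m : ℕ} {M : Type*} [TopologicalSpace M] [ChartedSpace (R m) M]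
    [IsManifold (𝓡 m) ∞ M] {κ : N → M} (C : EhresmannConnection (V := V) (W := R m) κ)
    (η : DForm (R m) M m) (y : N) : ⋀[ℝ]^m (TangentSpace 𝓘(ℝ, V) y) :=
  exteriorPower.map m (C.lift y).toLinearMap (unitMultivector η (κ y))

/-- The 1-form `i(Y)α`, `Y` being the `m`-vector field associated with the connection and `η`. -/
def gammaForm [FiniteDimensional ℝ V] {m : ℕ} {M : Type*} [TopologicalSpace M]
    [ChartedSpace (R m) M] [IsManifold (𝓡 m) ∞ M] {κ : N → M}
    (C : EhresmannConnection (V := V) (W := R m) κ) (η : DForm (R m) M m)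
    (α : DForm V N (m + 1)) : DForm V N 1 :=
  fun y => contract (C.multivector η y) (α y)

/-- The form `α^∇`, consisting of all the components of `α` but the one of bidegree `(m, 1)`. -/
def remainder (C : EhresmannConnection (V := V) (W := W) κ) {m : ℕ} (α : DForm V N (m + 1)) :
    DForm V N (m + 1) :=
  α - C.bidegreePart m α

end EhresmannConnection

end Forms

section Lagrangian

variable {m n : ℕ} {M E : Type*} [TopologicalSpace M] [ChartedSpace (R m) M]
  [TopologicalSpace E] [ChartedSpace (R (m + n)) E]
  {π : FibredManifold m n M E}

/-- The projection `J¹π → M`. -/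
def Jet.toBase (j : Jet π) : M := π.proj j.point

/-- The space `T_x^* M ⊗ V_e π` of linear maps `T_x M → T_e E`, `x = π e`, with values in the
vertical space `V_e π`. -/
def vertHom (π : FibredManifold m n M E) (e : E) : Submodule ℝ (R m →L[ℝ] R (m + n)) where
  carrier := {u | (AdaptedChart.dProj π e).comp u = 0}
  add_mem' {u v} hu hv := by
    have hu' : (AdaptedChart.dProj π e).comp u = 0 := hu
    have hv' : (AdaptedChart.dProj π e).comp v = 0 := hv
    simp [hu', hv']
  zero_mem' := by simp
  smul_mem' a u hu := by
    have hu' : (AdaptedChart.dProj π e).comp u = 0 := hu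
    change (AdaptedChart.dProj π e).comp (a • u) = 0
    rw [ContinuousLinearMap.comp_smul, hu']
    exact smul_zero (A := R m →L[ℝ] R m) a

/-- The affine structure of the fibres of `J¹π → E`: the 1-jet `j + u`. -/
def Jet.translate (j : Jet π) (u : vertHom π j.point) : Jet π where
  point := j.point
  lift := (j.tangent + u.1 : R m →L[ℝ] R (m + n))
  mfderiv_comp_lift := by
    have h1 := j.dProj_comp_tangent
    have h2 : (AdaptedChart.dProj π j.point).comp u.1 = 0 := u.2
    change (AdaptedChart.dProj π j.point).comp (j.tangent + u.1) = .id ℝ (R m)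
    rw [ContinuousLinearMap.comp_add, h1, h2, add_zero]

/-- The vertical lift `T_x^* M ⊗ V_e π → T_j J¹π`, which sends `u` to the velocity at `t = 0` of the
curve `t ↦ j + t u`. -/
def Jet.vertLift (j : Jet π) :
    vertHom π j.point →L[ℝ] TangentSpace 𝓘(ℝ, JetModel m n) j :=
  mfderiv 𝓘(ℝ, vertHom π j.point) 𝓘(ℝ, JetModel m n) j.translate 0

/-- The contact form (structure canonical form) of `J¹π`: at the 1-jet `j` of `φ` it is
`X ↦ Tπ¹ X - Tφ (Tπ̄¹ X)`, in coordinates `(dy^A - v^A_α dx^α) ⊗ ∂/∂y^A`. -/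
def Jet.contact (j : Jet π) : TangentSpace 𝓘(ℝ, JetModel m n) j →L[ℝ] R (m + n) :=
  let d : JetModel m n →L[ℝ] R (m + n) :=
    mfderiv 𝓘(ℝ, JetModel m n) (𝓡 (m + n)) (Jet.point (π := π)) j
  d - j.tangent.comp ((AdaptedChart.dProj π j.point).comp d)

theorem Jet.dProj_contact (j : Jet π) (X : TangentSpace 𝓘(ℝ, JetModel m n) j) :
    AdaptedChart.dProj π j.point (j.contact X) = 0 := by
  set d : JetModel m n →L[ℝ] R (m + n) :=
    mfderiv 𝓘(ℝ, JetModel m n) (𝓡 (m + n)) (Jet.point (π := π)) j with hd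
  have h (w : R m) : AdaptedChart.dProj π j.point (j.tangent w) = w :=
    DFunLike.congr_fun j.dProj_comp_tangent w
  change AdaptedChart.dProj π j.point
    (d X - j.tangent (AdaptedChart.dProj π j.point (d X))) = 0
  rw [map_sub, h, sub_self]

/-- The vertical endomorphism `𝒱` of `J¹π`, in coordinates
`(dy^A - v^A_α dx^α) ⊗ ∂/∂v^A_ν ⊗ ∂/∂x^ν`, as a map that sends a covector `a ∈ T_x^* M` to the
endomorphism `X ↦ (a ⊗ contact X)^{lift}` of `T_j J¹π`. -/
def Jet.verticalEndo (j : Jet π) (a : TangentSpace (𝓡 m) j.toBase →L[ℝ] ℝ) :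
    TangentSpace 𝓘(ℝ, JetModel m n) j →L[ℝ] TangentSpace 𝓘(ℝ, JetModel m n) j :=
  j.vertLift.comp
    (((ContinuousLinearMap.smulRightL ℝ (R m) (R (m + n)) a).comp j.contact).codRestrict
      (vertHom π j.point) (by
        intro X
        refine ContinuousLinearMap.ext fun (w : R m) => ?_
        have h := j.dProj_contact X
        change AdaptedChart.dProj π j.point
          ((a : R m →L[ℝ] ℝ) w • (j.contact X : R (m + n))) = 0
        rw [map_smul, h, smul_zero]))

variable (η : DForm (R m) M m) (L : Jet π → ℝ)

/-- The pullback `ω` of the volume form to `J¹π`. -/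
def omegaForm : DForm (JetModel m n) (Jet π) m := η.pullback Jet.toBase

/-- The Lagrangian density `ℒ = L ω`. -/
def lagrangianDensity : DForm (JetModel m n) (Jet π) m := fun j => L j • omegaForm η j

/-- The contraction of the vertical endomorphism with `dL`,
`∂L/∂v^A_ν (dy^A - v^A_α dx^α) ⊗ ∂/∂x^ν`, as a linear map `T_j J¹π → T_x M`. -/
def momentumMap (j : Jet π) :
    TangentSpace 𝓘(ℝ, JetModel m n) j →L[ℝ] TangentSpace (𝓡 m) j.toBase :=
  let dL : TangentSpace 𝓘(ℝ, JetModel m n) j →L[ℝ] ℝ := mfderiv 𝓘(ℝ, JetModel m n) 𝓘(ℝ, ℝ) L j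
  ∑ μ : Fin m, (dL.comp (j.verticalEndo (cotangentBasis j.toBase μ))).smulRight
    (tangentBasis j.toBase μ)

/-- The contraction `i(𝒱)ℒ`, in coordinates `∂L/∂v^A_ν (dy^A - v^A_α dx^α) ∧ i(∂/∂x^ν) ω`: the sum
over the positions `i` of `η` evaluated on the projections of the `X_k` to `M`, with
`momentumMap X_i` in the `i`-th position. -/
def contractVerticalEndo : DForm (JetModel m n) (Jet π) m := fun j =>
  mixedPart 1 (η j.toBase) (momentumMap L j)
    (mfderiv 𝓘(ℝ, JetModel m n) (𝓡 m) (Jet.toBase (π := π)) j)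

/-- The Poincaré–Cartan `m`-form `Θ_ℒ = i(𝒱)ℒ + ℒ`. -/
def poincareCartanTheta : DForm (JetModel m n) (Jet π) m :=
  contractVerticalEndo η L + lagrangianDensity η L

/-- The Poincaré–Cartan `(m+1)`-form `Ω_ℒ = -dΘ_ℒ`. -/
def poincareCartanOmega : DForm (JetModel m n) (Jet π) (m + 1) :=
  -(poincareCartanTheta η L).extDeriv

end Lagrangian

end FieldTheory

end

/-! Everything rests on counting vertical arguments. In the natural coordinates `(x, y, v)` every
term of `Θ_ℒ` contains at least `m - 1` of the `dx^α`: in `L ω` there are `m`, and in `i(𝒱)ℒ` only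
one slot of `η` is replaced by the momentum. Hence `Θ_ℒ` vanishes on two vertical vectors
(`poincareCartanTheta_inChart_eq_zero`). Being vertical means having zero `x`-component, a condition
with constant coefficients in the chart. Each term of `dΘ_ℒ` uses one argument as direction of
differentiation, so three vertical arguments leave two inside `Θ_ℒ`, and `Ω_ℒ` vanishes
(`poincareCartanOmega_eq_zero`).

For a connection, the bidegrees `(p, m + 1 - p)` with `p ≤ m - 2` are therefore absent, while `(m +
1, 0)` is absent because horizontal spaces have dimension `m`. Only `(m, 1)` and `(m - 1, 2)` remain
(`sub_mixedPart_eq_mixedPart`).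

The `(m, 1)` component is `ω ∧ γ` because forms of top degree on `T_x M` are proportional and `𝒵` is
normalised by `η(𝒵) = 1` (`wedge_contract_eq_mixedPart`).

Smoothness is checked in charts. `Θ_ℒ` has an explicit coordinate expression, `d` and the horizontal
projection preserve smoothness, and `γ` is locally a quotient of smooth functions with denominator a
coefficient of `η`. -/

open scoped Manifold ContDiff

noncomputable section

namespace FieldTheory

/-! ### Multilinear algebra: bidegree components and the wedge with a 1-form. -/

section MixedAlgebra

variable {T : Type*} [AddCommGroup T] [Module ℝ T] [TopologicalSpace T] {k : ℕ}

/-- Taking the component of a given type with respect to a pair of complementary projections is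
idempotent. -/
theorem mixedPart_mixedPart_self (p : ℕ) (f : T [⋀^Fin k]→L[ℝ] ℝ) {A B : T →L[ℝ] T}
    (hAA : ∀ v, A (A v) = A v) (hBB : ∀ v, B (B v) = B v)
    (hAB : ∀ v, A (B v) = 0) :
    mixedPart p (mixedPart p f A B) A B = mixedPart p f A B := by
  ext v
  rw [mixedPart_apply, mixedPart_apply]
  refine Finset.sum_congr rfl fun S hS => ?_
  rw [mixedPart_apply, Finset.sum_eq_single S]
  · congr 1
    funext i
    split_ifs <;> simp [*]
  -- Distinct sets of the same size `p`: some slot lies in `S'` but not in `S`, and there the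
  -- argument is `A (B _) = 0`.
  · intro S' hS' hne
    obtain ⟨i, hi, hi'⟩ : ∃ i, i ∈ S' ∧ i ∉ S := by
      by_contra! h
      exact hne (Finset.eq_of_subset_of_card_le h
        (by rw [(Finset.mem_powersetCard.1 hS).2, (Finset.mem_powersetCard.1 hS').2]))
    exact f.map_coord_zero i (by simp [hi, hi', hAB])
  · exact fun h => (h hS).elim

/-- A form is the sum of its components with respect to a pair of complementary maps. -/
theorem eq_sum_mixedPart (f : T [⋀^Fin k]→L[ℝ] ℝ) {A B : T →L[ℝ] T}
    (h : ∀ v, A v + B v = v) (v : Fin k → T) :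
    f v = ∑ p ∈ Finset.range (k + 1), mixedPart p f A B v := by
  have h1 := f.toMultilinearMap.map_add_univ (fun i => A (v i)) (fun i => B (v i))
  have h2 : ((fun i => A (v i)) + fun i => B (v i)) = v := funext fun i => h _
  rw [h2] at h1
  change f v = _ at h1
  rw [h1]
  simp only [mixedPart_apply]
  -- Multilinearity gives one term for each subset of slots; the terms are grouped by cardinality.
  rw [← Finset.powerset_univ, ← Finset.sum_fiberwise_of_maps_to (t := Finset.range (k + 1))
    (g := Finset.card) (s := Finset.powerset Finset.univ)]
  · refine Finset.sum_congr rfl fun p _ => ?_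
    rw [← Finset.powersetCard_eq_filter]
    refine Finset.sum_congr rfl fun S _ => ?_
    change f _ = f _
    congr 1
  · intro S _
    rw [Finset.mem_range, Nat.lt_succ_iff]
    simpa using S.card_le_univ

/-- A form vanishing on `q` vectors in the range of `B` has no component with `q` or more factors
in the direction of `B`. -/
theorem mixedPart_eq_zero {p q : ℕ} (f : T [⋀^Fin k]→L[ℝ] ℝ) {A B : T →L[ℝ] T}
    (h : ∀ (S : Finset (Fin k)) (v : Fin k → T), S.card = q → (∀ i ∈ S, ∃ u, v i = B u) → f v = 0)
    (hpq : p + q ≤ k) : mixedPart p f A B = 0 := by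
  ext v
  rw [mixedPart_apply]
  refine Finset.sum_eq_zero fun S hS => ?_
  have hc : q ≤ (Sᶜ).card := by
    rw [Finset.card_compl, (Finset.mem_powersetCard.1 hS).2, Fintype.card_fin]
    omega
  obtain ⟨S', hS', hcard⟩ := Finset.exists_subset_card_eq hc
  refine h S' _ hcard fun i hi => ⟨v i, ?_⟩
  have := Finset.mem_compl.1 (hS' hi)
  simp [this]

/-- Each value is the image of the last index under exactly `m!` permutations. Composing with a swap
moves the question to the index `0`, where `decomposeFin` separates the image of `0` from a
permutation of `Fin m`. -/
theorem sum_perm_apply_last {m : ℕ} (g : Fin (m + 1) → ℝ) :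
    ∑ σ : Equiv.Perm (Fin (m + 1)), g (σ (Fin.last m)) = (m.factorial : ℝ) * ∑ i, g i := by
  rw [← Equiv.sum_comp (Equiv.mulRight (Equiv.swap 0 (Fin.last m)))
    (fun σ : Equiv.Perm (Fin (m + 1)) => g (σ (Fin.last m)))]
  simp only [Equiv.coe_mulRight, Equiv.Perm.mul_apply, Equiv.swap_apply_right]
  rw [← Equiv.Perm.decomposeFin.symm.sum_comp, Fintype.sum_prod_type]
  simp [Fintype.card_perm, Finset.mul_sum]

/-- If `α ⊗ β`, with `β` a 1-form, is `f` evaluated on `A` in the first `m` places and on `B` in the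
last one, then `α ∧ β` is the component of `f` with `m` factors in the direction of `A`. -/
theorem wedge_one_eq_mixedPart {m : ℕ} (α : T [⋀^Fin m]→ₗ[ℝ] ℝ) (β : T [⋀^Fin 1]→ₗ[ℝ] ℝ)
    (f : T [⋀^Fin (m + 1)]→L[ℝ] ℝ) (A B : T →L[ℝ] T)
    (h : ∀ v : Fin (m + 1) → T, α (fun i => v i.castSucc) * β (fun _ => v (Fin.last m)) =
      f fun i => if i = Fin.last m then B (v i) else A (v i)) :
    wedge α β = (mixedPart m f A B).toAlternatingMap := by
  ext v
  have hm : (m.factorial : ℝ) ≠ 0 := by exact_mod_cast m.factorial_ne_zero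
  -- The sum over shuffles is a sum over a quotient of the permutations. Multiplied by `m! · 1!` it
  -- becomes the full alternatization, which can be computed term by term.
  have key : (m.factorial : ℝ) * wedge α β v = (m.factorial : ℝ) * ∑ i : Fin (m + 1),
      f fun j => if j = i then B (v j) else A (v j) := by
    have h1 := congrArg (fun g => LinearMap.mul' ℝ ℝ (g (fun i => v (finSumFinEquiv i))))
      (MultilinearMap.domCoprod_alternization_eq α β)
    simp only [Fintype.card_fin, Nat.factorial_one, mul_one] at h1
    have h2 : (m.factorial : ℝ) * wedge α β v =
      LinearMap.mul' ℝ ℝ ((m.factorial • α.domCoprod β) (fun i => v (finSumFinEquiv i))) := by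
      rw [AlternatingMap.smul_apply, map_nsmul, nsmul_eq_mul]
      rfl
    rw [h2, ← h1, ← sum_perm_apply_last, MultilinearMap.alternatization_apply, map_sum,
      ← Equiv.sum_comp (finSumFinEquiv (m := m) (n := 1)).permCongr]
    refine Finset.sum_congr rfl fun σ _ => ?_
    set τ := finSumFinEquiv.permCongr σ with hτ
    have hs : Equiv.Perm.sign τ = Equiv.Perm.sign σ := Equiv.Perm.sign_permCongr _ _
    have e1 : ∀ i, finSumFinEquiv (σ (Sum.inl i)) = τ (Fin.castSucc i) := fun i => by
      have : (finSumFinEquiv (m := m) (n := 1)).symm (Fin.castSucc i) = Sum.inl i := by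
        rw [Equiv.symm_apply_eq]; rfl
      simp only [hτ, Equiv.permCongr_apply, this]
    have e2 : ∀ i, finSumFinEquiv (σ (Sum.inr i)) = τ (Fin.last m) := fun i => by
      have : (finSumFinEquiv (m := m) (n := 1)).symm (Fin.last m) = Sum.inr i := by
        rw [Equiv.symm_apply_eq, Subsingleton.elim i 0]; rfl
      simp only [hτ, Equiv.permCongr_apply, this]
    -- By antisymmetry of `f`, reordering the arguments produces the sign of `τ`, which cancels the
    -- one in the alternatization. The term then depends only on `τ (Fin.last m)`.
    have h3 := f.toAlternatingMap.map_perm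
      (fun j => if j = τ (Fin.last m) then B (v j) else A (v j)) τ
    have h4 := h (v ∘ τ)
    change α (fun i => v (τ i.castSucc)) * β (fun _ => v (τ (Fin.last m))) =
      f (fun i => if i = Fin.last m then B (v (τ i)) else A (v (τ i))) at h4
    have h5 : (fun i => if i = Fin.last m then B (v (τ i)) else A (v (τ i))) =
        (fun j => if j = τ (Fin.last m) then B (v j) else A (v j)) ∘ τ := by
      funext i
      simp
    rw [h5] at h4
    change f _ = Equiv.Perm.sign τ • f _ at h3
    rw [h3, hs] at h4
    have h6 : LinearMap.mul' ℝ ℝ ((Equiv.Perm.sign σ • MultilinearMap.domDomCongr σ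
        (α.toMultilinearMap.domCoprod β.toMultilinearMap)) fun i => v (finSumFinEquiv i)) =
        Equiv.Perm.sign σ • (α (fun i => v (finSumFinEquiv (σ (Sum.inl i)))) *
          β (fun i => v (finSumFinEquiv (σ (Sum.inr i))))) := by
      rw [_root_.smul_apply, Units.smul_def, map_zsmul]
      rfl
    refine (Eq.trans ?_ h6).trans ?_
    · rfl
    · simp only [e1, e2]
      rw [h4, smul_smul, Int.units_mul_self, one_smul]
  rw [mul_right_injective₀ hm key]
  change _ = mixedPart m f A B v
  rw [mixedPart_apply]
  -- A set of `m` slots among `m + 1` is the complement of the single slot that receives `B`.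
  refine Finset.sum_bij (fun i _ => {i}ᶜ) ?_ ?_ ?_ ?_
  · intro i _
    simp [Finset.mem_powersetCard, Finset.card_compl]
  · intro i _ j _ hij
    simpa using hij
  · intro S hS
    have : Sᶜ.card = 1 := by
      rw [Finset.card_compl, (Finset.mem_powersetCard.1 hS).2, Fintype.card_fin]
      omega
    obtain ⟨i, hi⟩ := Finset.card_eq_one.1 this
    exact ⟨i, Finset.mem_univ _, by rw [← hi, compl_compl]⟩
  · intro i _
    congr 1
    funext j
    by_cases hj : j = i <;> simp [hj]

/-- Two forms of top degree on `ℝᵐ` are proportional. -/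
theorem apply_mul_apply_basis {m : ℕ} {W : Type*} [AddCommGroup W] [Module ℝ W]
    (b : Module.Basis (Fin m) ℝ W) (f g : W [⋀^Fin m]→ₗ[ℝ] ℝ) (x : Fin m → W) :
    f x * g b = g x * f b := by
  rw [f.eq_smul_basis_det b, g.eq_smul_basis_det b]
  simp [b.det_self]
  ring

end MixedAlgebra

/-! ### Smooth families of alternating forms on a finite-dimensional space. -/

section FormAnalysis

variable {V X : Type*} [NormedAddCommGroup V] [NormedSpace ℝ V] [FiniteDimensional ℝ V]
  [NormedAddCommGroup X] [NormedSpace ℝ X] {k : ℕ}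

/-- A map with values in the alternating forms on a finite-dimensional space is smooth if all its
evaluations are. -/
theorem contDiffAt_of_apply {f : X → V [⋀^Fin k]→L[ℝ] ℝ} {x : X}
    (h : ∀ v : Fin k → V, ContDiffAt ℝ ∞ (fun z => f z v) x) : ContDiffAt ℝ ∞ f x := by
  let b := Module.finBasis ℝ V
  let ι : (V [⋀^Fin k]→L[ℝ] ℝ) →ₗ[ℝ] ((Fin k → Fin (Module.finrank ℝ V)) → ℝ) :=
    { toFun := fun g r => g fun i => b (r i)
      map_add' := fun _ _ => rfl
      map_smul' := fun _ _ => rfl }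
  have hι : LinearMap.ker ι = ⊥ := by
    rw [LinearMap.ker_eq_bot]
    intro g g' hg
    refine ContinuousAlternatingMap.toAlternatingMap_injective
      (AlternatingMap.coe_multilinearMap_injective
        (Module.Basis.ext_multilinear (fun _ => b) fun r => congrFun hg r))
  -- The values on basis vectors embed the forms linearly in a finite product of copies of `ℝ`. A
  -- linear left inverse is continuous here, and recovers `f` from its smooth coefficients.
  obtain ⟨s, hs⟩ := ι.exists_leftInverse_of_injective hι
  have h1 : ContDiffAt ℝ ∞ (fun z => s.toContinuousLinearMap (ι (f z))) x :=
    (s.toContinuousLinearMap.contDiff.contDiffAt).comp x (contDiffAt_pi.2 fun r => h _)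
  have h2 : (fun z => s.toContinuousLinearMap (ι (f z))) = f := by
    funext z
    exact DFunLike.congr_fun hs (f z)
  rwa [h2] at h1

/-- Evaluation of a smooth family of alternating forms on smooth families of vectors. -/
theorem contDiffAt_alternating_apply {f : X → V [⋀^Fin k]→L[ℝ] ℝ} {u : Fin k → X → V} {x : X}
    (hf : ContDiffAt ℝ ∞ f x) (hu : ∀ i, ContDiffAt ℝ ∞ (u i) x) :
    ContDiffAt ℝ ∞ (fun z => f z fun i => u i z) x := by
  let b := Module.finBasis ℝ V
  have h1 : (fun z => f z fun i => u i z) = fun z => ∑ r : Fin k → Fin (Module.finrank ℝ V),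
      (∏ i, b.repr (u i z) (r i)) * f z fun i => b (r i) := by
    funext z
    have e1 : (fun i => u i z) = fun i => ∑ j, b.repr (u i z) j • b j :=
      funext fun i => (b.sum_repr _).symm
    have e2 := (f z).toMultilinearMap.map_sum (fun i j => b.repr (u i z) j • b j)
    have e3 : ∀ r : Fin k → Fin (Module.finrank ℝ V), _ := fun r =>
      (f z).toMultilinearMap.map_smul_univ (fun i => b.repr (u i z) (r i)) fun i => b (r i)
    simp only [e3] at e2
    rw [e1]
    simpa using e2
  rw [h1]
  refine ContDiffAt.sum fun r _ => ContDiffAt.mul (contDiffAt_prod fun i _ => ?_) ?_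
  · exact ((b.coord (r i)).toContinuousLinearMap.contDiff.contDiffAt).comp x (hu i)
  · exact ((ContinuousAlternatingMap.apply ℝ V ℝ fun i => b (r i)).contDiff.contDiffAt).comp x hf

end FormAnalysis

/-! ### Differential forms on manifolds: pullback, charts and exterior derivative. -/

section ManifoldForms

open Filter Topology

variable {V X : Type*} [NormedAddCommGroup V] [NormedSpace ℝ V]
  [NormedAddCommGroup X] [NormedSpace ℝ X]
  {N : Type*} [TopologicalSpace N] [ChartedSpace V N] {k : ℕ}

/-- The type of `α a` depends on `a`. Reading all vectors in the model space `V` makes values at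
propositionally equal points comparable. -/
theorem DForm.apply_congr (α : DForm V N k) {a b : N} (h : a = b) {w w' : Fin k → V}
    (hw : w = w') :
    (α a : V [⋀^Fin k]→L[ℝ] ℝ) w = (α b : V [⋀^Fin k]→L[ℝ] ℝ) w' := by
  subst h hw
  rfl

/-- The differential of a map from a normed space to a manifold, read in the model spaces. -/
def dMap (V : Type*) [NormedAddCommGroup V] [NormedSpace ℝ V] {N : Type*} [TopologicalSpace N]
    [ChartedSpace V N] (g : X → N) (p : X) : X →L[ℝ] V := mfderiv 𝓘(ℝ, X) 𝓘(ℝ, V) g p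

/-- The pullback of a form to a normed space. -/
def DForm.pull (α : DForm V N k) (g : X → N) (p : X) : X [⋀^Fin k]→L[ℝ] ℝ :=
  (α (g p) : V [⋀^Fin k]→L[ℝ] ℝ).compContinuousLinearMap (dMap V g p)

theorem DForm.pull_apply (α : DForm V N k) (g : X → N) (p : X) (v : Fin k → X) :
    α.pull g p v = (α (g p) : V [⋀^Fin k]→L[ℝ] ℝ) fun i => dMap V g p (v i) := rfl

theorem DForm.inChart_eq_pull (α : DForm V N k) (y : N) :
    α.inChart y = α.pull (chartAt V y).symm := rfl

theorem DForm.pull_congr (α : DForm V N k) {g g' : X → N} {p : X} (h : g =ᶠ[𝓝 p] g') :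
    α.pull g p = α.pull g' p := by
  ext v
  refine α.apply_congr h.self_of_nhds (funext fun i => ?_)
  exact DFunLike.congr_fun (h.mfderiv_eq (I := 𝓘(ℝ, X)) (I' := 𝓘(ℝ, V))) (v i)

theorem DForm.pull_comp {Y : Type*} [NormedAddCommGroup Y] [NormedSpace ℝ Y]
    (α : DForm V N k) {g : X → N} {h : Y → X} {p : Y}
    (hg : MDifferentiableAt 𝓘(ℝ, X) 𝓘(ℝ, V) g (h p)) (hh : DifferentiableAt ℝ h p) :
    α.pull (g ∘ h) p = (α.pull g (h p)).compContinuousLinearMap (fderiv ℝ h p) := by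
  ext v
  refine α.apply_congr rfl (funext fun i => ?_)
  have := mfderiv_comp (I := 𝓘(ℝ, Y)) (I' := 𝓘(ℝ, X)) (I'' := 𝓘(ℝ, V)) p hg
    hh.mdifferentiableAt
  rw [mfderiv_eq_fderiv] at this
  exact DFunLike.congr_fun this (v i)

section

variable [IsManifold 𝓘(ℝ, V) ∞ N]

theorem contMDiffAt_chartAt {y₀ y : N} (hy : y ∈ (chartAt V y₀).source) :
    ContMDiffAt 𝓘(ℝ, V) 𝓘(ℝ, V) ∞ (chartAt V y₀) y :=
  contMDiffAt_of_mem_maximalAtlas (IsManifold.chart_mem_maximalAtlas y₀) hy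

theorem contMDiffAt_chartAt_symm {y₀ : N} {z : V} (hz : z ∈ (chartAt V y₀).target) :
    ContMDiffAt 𝓘(ℝ, V) 𝓘(ℝ, V) ∞ (chartAt V y₀).symm z :=
  contMDiffAt_symm_of_mem_maximalAtlas (IsManifold.chart_mem_maximalAtlas y₀) hz

theorem contDiffAt_chartAt_comp {y₀ : N} {g : X → N} {p : X}
    (hg : ContMDiffAt 𝓘(ℝ, X) 𝓘(ℝ, V) ∞ g p) (hp : g p ∈ (chartAt V y₀).source) :
    ContDiffAt ℝ ∞ (chartAt V y₀ ∘ g) p :=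
  contMDiffAt_iff_contDiffAt.1 ((contMDiffAt_chartAt hp).comp p hg)

/-- The pullback of a form in terms of its expression in a chart. -/
theorem DForm.pull_eventuallyEq (α : DForm V N k) {y₀ : N} {g : X → N} {p : X}
    (hg : ContMDiffAt 𝓘(ℝ, X) 𝓘(ℝ, V) ∞ g p) (hp : g p ∈ (chartAt V y₀).source) :
    α.pull g =ᶠ[𝓝 p] fun q => (α.inChart y₀ ((chartAt V y₀ ∘ g) q)).compContinuousLinearMap
      (fderiv ℝ (chartAt V y₀ ∘ g) q) := by
  have h1 : ∀ᶠ q in 𝓝 p, g q ∈ (chartAt V y₀).source :=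
    hg.continuousAt.preimage_mem_nhds ((chartAt V y₀).open_source.mem_nhds hp)
  -- `ContDiffAt` of order `∞` need not propagate to a neighbourhood, whereas order `1` does and is
  -- enough for the chain rule.
  have h2 : ∀ᶠ q in 𝓝 p, ContDiffAt ℝ 1 (chartAt V y₀ ∘ g) q :=
    ((contDiffAt_chartAt_comp hg hp).of_le (by simp)).eventually (by simp)
  filter_upwards [h1.eventually_nhds, h2] with q hq hq'
  have h3 : g =ᶠ[𝓝 q] (chartAt V y₀).symm ∘ (chartAt V y₀ ∘ g) := by
    filter_upwards [hq] with r hr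
    exact ((chartAt V y₀).left_inv hr).symm
  rw [α.pull_congr h3, DForm.pull_comp]
  · rfl
  · exact (contMDiffAt_chartAt_symm ((chartAt V y₀).map_source hq.self_of_nhds)).mdifferentiableAt
      (by simp)
  · exact hq'.differentiableAt (by simp)

theorem DForm.contDiffAt_pull [FiniteDimensional ℝ X] [FiniteDimensional ℝ V]
    (α : DForm V N k) {y₀ : N} {g : X → N} {p : X}
    (hg : ContMDiffAt 𝓘(ℝ, X) 𝓘(ℝ, V) ∞ g p) (hp : g p ∈ (chartAt V y₀).source)
    (hα : ContDiffAt ℝ ∞ (α.inChart y₀) (chartAt V y₀ (g p))) : ContDiffAt ℝ ∞ (α.pull g) p := by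
  refine ContDiffAt.congr_of_eventuallyEq ?_ (α.pull_eventuallyEq hg hp)
  have h1 := contDiffAt_chartAt_comp hg hp
  refine contDiffAt_of_apply fun v => ?_
  exact contDiffAt_alternating_apply (u := fun i q => fderiv ℝ (chartAt V y₀ ∘ g) q (v i))
    (ContDiffAt.comp p hα h1)
    fun i => (h1.fderiv_right (m := ∞) (by simp)).clm_apply contDiffAt_const

theorem DForm.IsSmooth.contDiffAt_pull [FiniteDimensional ℝ X] [FiniteDimensional ℝ V]
    {α : DForm V N k} (hα : α.IsSmooth) {g : X → N} {p : X}
    (hg : ContMDiffAt 𝓘(ℝ, X) 𝓘(ℝ, V) ∞ g p) : ContDiffAt ℝ ∞ (α.pull g) p :=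
  α.contDiffAt_pull hg (mem_chart_source V (g p)) ((hα (g p)).contDiffAt
    ((chartAt V (g p)).open_target.mem_nhds (mem_chart_target V (g p))))

/-- To check that a form is smooth it is enough to look at each point in the preferred chart. -/
theorem DForm.isSmooth_of_contDiffAt [FiniteDimensional ℝ V] {α : DForm V N k}
    (h : ∀ y, ContDiffAt ℝ ∞ (α.inChart y) (chartAt V y y)) : α.IsSmooth := fun y z hz =>
  (α.contDiffAt_pull (contMDiffAt_chartAt_symm hz) (mem_chart_source V _)
    (h ((chartAt V y).symm z))).contDiffWithinAt

/-- `DForm.extDeriv` uses a different chart at every point. Since `d` on a normed space commutes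
with pullback by the transition maps, the choice is immaterial and a single chart serves all points
of its domain. -/
theorem DForm.inChart_extDeriv [FiniteDimensional ℝ V] {α : DForm V N k} (hα : α.IsSmooth)
    {y₀ : N} {z : V} (hz : z ∈ (chartAt V y₀).target) :
    α.extDeriv.inChart y₀ z = _root_.extDeriv (α.inChart y₀) z := by
  set y := (chartAt V y₀).symm z with hy
  have hs := contMDiffAt_chartAt_symm hz
  have h1 := α.pull_eventuallyEq (y₀ := y) hs (mem_chart_source V y)
  have h2 : ContDiffAt ℝ ∞ (α.inChart y) (chartAt V y y) := (hα y).contDiffAt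
    ((chartAt V y).open_target.mem_nhds (mem_chart_target V y))
  have h3 := contDiffAt_chartAt_comp (y₀ := y) hs (mem_chart_source V y)
  have h5 : _root_.extDeriv (fun q =>
      (α.inChart y ((chartAt V y ∘ (chartAt V y₀).symm) q)).compContinuousLinearMap
        (fderiv ℝ (chartAt V y ∘ (chartAt V y₀).symm) q)) z =
      (_root_.extDeriv (α.inChart y)
        ((chartAt V y ∘ (chartAt V y₀).symm) z)).compContinuousLinearMap
          (fderiv ℝ (chartAt V y ∘ (chartAt V y₀).symm) z) :=
    extDeriv_pullback (r := ∞) (h2.differentiableAt (by simp)) h3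
      (by rw [minSmoothness_of_isRCLikeNormedField]; exact WithTop.coe_le_coe.2 (le_top (a := (2 : ℕ∞))))
  rw [DForm.inChart_eq_pull α y₀, h1.extDeriv_eq, h5]
  ext v
  have h4 := mfderiv_comp z ((contMDiffAt_chartAt (mem_chart_source V y)).mdifferentiableAt
    (by simp)) (hs.mdifferentiableAt (by simp))
  rw [mfderiv_eq_fderiv] at h4
  exact congrArg (_root_.extDeriv (α.inChart y) (chartAt V y y))
    (funext fun i => (DFunLike.congr_fun h4 (v i)).symm)

theorem DForm.IsSmooth.extDeriv [FiniteDimensional ℝ V] {α : DForm V N k} (hα : α.IsSmooth) :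
    α.extDeriv.IsSmooth := by
  intro y₀
  have ho := (chartAt V y₀).open_target
  refine ContDiffOn.congr (f := _root_.extDeriv (α.inChart y₀)) ?_
    fun z hz => DForm.inChart_extDeriv hα hz
  exact (ContinuousAlternatingMap.alternatizeUncurryFinCLM ℝ V ℝ).contDiff.comp_contDiffOn
    ((hα y₀).fderiv_of_isOpen (m := ∞) ho (by simp))

end

theorem DForm.isSmooth_of_apply [FiniteDimensional ℝ V] {α : DForm V N k}
    (h : ∀ y₀, ∀ z ∈ (chartAt V y₀).target, ∀ v : Fin k → V,
      ContDiffAt ℝ ∞ (fun q => α.inChart y₀ q v) z) : α.IsSmooth := fun y₀ z hz =>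
  (contDiffAt_of_apply (h y₀ z hz)).contDiffWithinAt

/-- If a form vanishes on two vectors of some kind, its exterior derivative vanishes on three of
them. -/
theorem extDeriv_apply_eq_zero {f : V → V [⋀^Fin k]→L[ℝ] ℝ} {x : V}
    (hf : DifferentiableAt ℝ f x) {P : V → Prop}
    (h : ∀ᶠ z in 𝓝 x, ∀ (v : Fin k → V) (a b : Fin k), a ≠ b → P (v a) → P (v b) → f z v = 0)
    (w : Fin (k + 1) → V) {i j l : Fin (k + 1)} (hij : i ≠ j) (hil : i ≠ l) (hjl : j ≠ l)
    (hi : P (w i)) (hj : P (w j)) (hl : P (w l)) : _root_.extDeriv f x w = 0 := by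
  rw [extDeriv_apply hf]
  refine Finset.sum_eq_zero fun r _ => ?_
  -- The `r`-th term of `d` omits `w r` from the arguments of `f`; at least two of the three
  -- distinguished vectors survive.
  have aux : ∀ i' j' : Fin (k + 1), i' ≠ j' → i' ≠ r → j' ≠ r → P (w i') → P (w j') →
      ∃ a b : Fin k, a ≠ b ∧ P (r.removeNth w a) ∧ P (r.removeNth w b) := by
    intro i' j' hij' hir hjr h1 h2
    obtain ⟨a, rfl⟩ := Fin.exists_succAbove_eq hir
    obtain ⟨b, rfl⟩ := Fin.exists_succAbove_eq hjr
    exact ⟨a, b, fun h => hij' (by rw [h]), h1, h2⟩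
  have hab : ∃ a b : Fin k, a ≠ b ∧ P (r.removeNth w a) ∧ P (r.removeNth w b) := by
    by_cases h1 : i = r
    · exact aux j l hjl (h1 ▸ hij.symm) (h1 ▸ hil.symm) hj hl
    · by_cases h2 : j = r
      · exact aux i l hil h1 (h2 ▸ hjl.symm) hi hl
      · exact aux i j hij h1 h2 hi hj
  obtain ⟨a, b, hne, ha, hb⟩ := hab
  -- `P` does not depend on `z` and the vectors are constant, so the differentiated function
  -- vanishes on a whole neighbourhood.
  have h0 : (fun z => f z (r.removeNth w)) =ᶠ[𝓝 x] fun _ => 0 :=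
    h.mono fun z hz => hz _ a b hne ha hb
  rw [h0.fderiv_eq]
  simp

theorem DForm.IsSmooth.extDeriv_apply_eq_zero {α : DForm V N k} (hα : α.IsSmooth) {P : V → Prop}
    {y : N} (h : ∀ z ∈ (chartAt V y).target, ∀ (v : Fin k → V) (a b : Fin k), a ≠ b → P (v a) →
      P (v b) → α.inChart y z v = 0)
    (v : Fin (k + 1) → TangentSpace 𝓘(ℝ, V) y) {i j l : Fin (k + 1)}
    (hij : i ≠ j) (hil : i ≠ l) (hjl : j ≠ l)
    (hP : ∀ r ∈ ({i, j, l} : Set (Fin (k + 1))),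
      P (mfderiv 𝓘(ℝ, V) 𝓘(ℝ, V) (chartAt V y) y (v r))) : α.extDeriv y v = 0 := by
  have ho := (chartAt V y).open_target.mem_nhds (mem_chart_target V y)
  exact FieldTheory.extDeriv_apply_eq_zero (((hα y).contDiffAt ho).differentiableAt (by simp))
    (Filter.eventually_of_mem ho h) (fun r => mfderiv 𝓘(ℝ, V) 𝓘(ℝ, V) (chartAt V y) y (v r))
    hij hil hjl (hP i (by simp)) (hP j (by simp)) (hP l (by simp))

theorem DForm.IsSmooth.neg {α : DForm V N k} (hα : α.IsSmooth) : (-α).IsSmooth := fun y₀ =>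
  (hα y₀).neg

end ManifoldForms

/-! ### The geometry of `J¹π` in natural coordinates. -/

section JetCharts

open Filter Topology

variable {m n : ℕ} {M E : Type*} [TopologicalSpace M] [ChartedSpace (R m) M]
  [TopologicalSpace E] [ChartedSpace (R (m + n)) E]
  {π : FibredManifold m n M E}

/-- The fibred coordinates that induce the preferred chart of `J¹π` at `j`. -/
def Jet.fibredChart (j : Jet π) : AdaptedChart π := (exists_adaptedChart π j.point).choose

theorem Jet.point_chartAt_symm {j₀ : Jet π} {p : JetModel m n}
    (hp : p ∈ (chartAt (JetModel m n) j₀).target) :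
    ((chartAt (JetModel m n) j₀).symm p).point = j₀.fibredChart.tot.symm p.1 := by
  have h1 := (chartAt (JetModel m n) j₀).map_target hp
  have h2 := (chartAt (JetModel m n) j₀).right_inv hp
  rw [← congrArg Prod.fst h2]
  exact (j₀.fibredChart.tot.left_inv h1).symm

theorem Jet.velocity_chartAt_symm {j₀ : Jet π} {p : JetModel m n}
    (hp : p ∈ (chartAt (JetModel m n) j₀).target) :
    j₀.fibredChart.velocity ((chartAt (JetModel m n) j₀).symm p) = p.2 :=
  congrArg Prod.snd ((chartAt (JetModel m n) j₀).right_inv hp)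

theorem AdaptedChart.proj_tot_symm (c : AdaptedChart π) {z : R m × R n} (hz : z ∈ c.tot.target) :
    π.proj (c.tot.symm z) = c.base.symm z.1 := by
  have h1 := c.tot.map_target hz
  have h2 := c.fst_tot _ h1
  rw [c.tot.right_inv hz] at h2
  rw [h2, c.base.left_inv (c.proj_mem _ h1)]

theorem AdaptedChart.fst_mem_base_target (c : AdaptedChart π) {z : R m × R n}
    (hz : z ∈ c.tot.target) : z.1 ∈ c.base.target := by
  have h1 := c.tot.map_target hz
  have h2 := c.fst_tot _ h1
  rw [c.tot.right_inv hz] at h2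
  rw [h2]
  exact c.base_mem_target h1

theorem Jet.toBase_chartAt_symm {j₀ : Jet π} {p : JetModel m n}
    (hp : p ∈ (chartAt (JetModel m n) j₀).target) :
    ((chartAt (JetModel m n) j₀).symm p).toBase = j₀.fibredChart.base.symm p.1.1 := by
  rw [Jet.toBase, Jet.point_chartAt_symm hp, j₀.fibredChart.proj_tot_symm hp]

theorem Jet.contMDiff_point :
    ContMDiff 𝓘(ℝ, JetModel m n) (𝓡 (m + n)) ∞ (Jet.point (π := π)) := by
  intro j
  have hj := mem_chart_source (JetModel m n) j
  have h1 := contMDiffAt_chartAt hj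
  have h2 : ContMDiffAt 𝓘(ℝ, JetModel m n) 𝓘(ℝ, R m × R n) ∞
      (Prod.fst : JetModel m n → R m × R n) (chartAt (JetModel m n) j j) :=
    contDiff_fst.contMDiff.contMDiffAt
  have h3 : ContMDiffAt 𝓘(ℝ, R m × R n) (𝓡 (m + n)) ∞ j.fibredChart.tot.symm
      (chartAt (JetModel m n) j j).1 := j.fibredChart.smooth_tot_symm.contMDiffAt
    (j.fibredChart.tot.open_target.mem_nhds ((chartAt (JetModel m n) j).map_source hj))
  refine ((h3.comp j (h2.comp j h1)).congr_of_eventuallyEq ?_)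
  filter_upwards [(chartAt (JetModel m n) j).open_source.mem_nhds hj] with j' hj'
  exact (j.fibredChart.tot.left_inv hj').symm

theorem Jet.contMDiff_toBase :
    ContMDiff 𝓘(ℝ, JetModel m n) (𝓡 m) ∞ (Jet.toBase (π := π)) :=
  π.smooth.comp Jet.contMDiff_point

/-- The differential of `J¹π → E`. -/
def Jet.dPoint (j : Jet π) : JetModel m n →L[ℝ] R (m + n) :=
  mfderiv 𝓘(ℝ, JetModel m n) (𝓡 (m + n)) (Jet.point (π := π)) j

/-- The differential of `J¹π → M`. -/
def Jet.dToBase (j : Jet π) : JetModel m n →L[ℝ] R m :=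
  mfderiv 𝓘(ℝ, JetModel m n) (𝓡 m) (Jet.toBase (π := π)) j

/-- The differential at `p` of the inverse of the preferred chart of `J¹π` at `j`. -/
def Jet.dChartSymm (j₀ : Jet π) (p : JetModel m n) : JetModel m n →L[ℝ] JetModel m n :=
  dMap (JetModel m n) (chartAt (JetModel m n) j₀).symm p

variable {j₀ : Jet π} {p : JetModel m n}

theorem Jet.mdifferentiableAt_chartAt_symm (hp : p ∈ (chartAt (JetModel m n) j₀).target) :
    MDifferentiableAt 𝓘(ℝ, JetModel m n) 𝓘(ℝ, JetModel m n)
      (chartAt (JetModel m n) j₀).symm p :=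
  (contMDiffAt_chartAt_symm hp).mdifferentiableAt (by simp)

/-- In natural coordinates `J¹π → E` is the projection `(x, y, v) ↦ (x, y)`; this is its
differential. -/
theorem Jet.dPoint_dChartSymm (hp : p ∈ (chartAt (JetModel m n) j₀).target) (X : JetModel m n) :
    ((chartAt (JetModel m n) j₀).symm p).dPoint (j₀.dChartSymm p X) =
      j₀.fibredChart.dTotSymm p.1 X.1 := by
  have h1 := mfderiv_comp p (Jet.contMDiff_point.mdifferentiableAt (by simp))
    (Jet.mdifferentiableAt_chartAt_symm hp)
  have h2 : (Jet.point ∘ (chartAt (JetModel m n) j₀).symm) =ᶠ[𝓝 p]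
      j₀.fibredChart.tot.symm ∘ Prod.fst := by
    filter_upwards [(chartAt (JetModel m n) j₀).open_target.mem_nhds hp] with q hq
    exact Jet.point_chartAt_symm hq
  have hf : HasMFDerivAt 𝓘(ℝ, JetModel m n) 𝓘(ℝ, R m × R n)
      (Prod.fst : JetModel m n → R m × R n) p
      (ContinuousLinearMap.fst ℝ (R m × R n) (R m →L[ℝ] R n)) :=
    (hasFDerivAt_fst (𝕜 := ℝ)).hasMFDerivAt
  have h3 := ((j₀.fibredChart.mdiff_tot_symm (z := p.1) hp).hasMFDerivAt.comp p hf).mfderiv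
  have h4 := h1.symm.trans (h2.mfderiv_eq.trans h3)
  exact DFunLike.congr_fun h4 X

theorem Jet.dToBase_dChartSymm (hp : p ∈ (chartAt (JetModel m n) j₀).target) (X : JetModel m n) :
    ((chartAt (JetModel m n) j₀).symm p).dToBase (j₀.dChartSymm p X) =
      j₀.fibredChart.dBaseSymm p.1.1 X.1.1 := by
  have h1 := mfderiv_comp p (Jet.contMDiff_toBase.mdifferentiableAt (by simp))
    (Jet.mdifferentiableAt_chartAt_symm hp)
  have h2 : (Jet.toBase ∘ (chartAt (JetModel m n) j₀).symm) =ᶠ[𝓝 p]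
      j₀.fibredChart.base.symm ∘ fun q => q.1.1 := by
    filter_upwards [(chartAt (JetModel m n) j₀).open_target.mem_nhds hp] with q hq
    exact Jet.toBase_chartAt_symm hq
  have hf : HasMFDerivAt 𝓘(ℝ, JetModel m n) (𝓡 m)
      (fun q : JetModel m n => q.1.1) p
      ((ContinuousLinearMap.fst ℝ (R m) (R n)).comp
        (ContinuousLinearMap.fst ℝ (R m × R n) (R m →L[ℝ] R n))) :=
    ((ContinuousLinearMap.fst ℝ (R m) (R n)).comp
      (ContinuousLinearMap.fst ℝ (R m × R n) (R m →L[ℝ] R n))).hasFDerivAt.hasMFDerivAt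
  have h3 := ((j₀.fibredChart.mdiff_base_symm (z := p.1.1)
    (AdaptedChart.fst_mem_base_target _ hp)).hasMFDerivAt.comp p hf).mfderiv
  have h4 := h1.symm.trans (h2.mfderiv_eq.trans h3)
  exact DFunLike.congr_fun h4 X

/-- The coordinate expression `dy^A - v^A_α dx^α` of the contact form. -/
theorem Jet.snd_dTot_contact (hp : p ∈ (chartAt (JetModel m n) j₀).target) (X : JetModel m n) :
    (j₀.fibredChart.dTot ((chartAt (JetModel m n) j₀).symm p).point
      (((chartAt (JetModel m n) j₀).symm p).contact (j₀.dChartSymm p X))).2 =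
      X.1.2 - p.2 X.1.1 := by
  set j := (chartAt (JetModel m n) j₀).symm p with hj
  set c := j₀.fibredChart
  have hs : j.point ∈ c.tot.source := (chartAt (JetModel m n) j₀).map_target hp
  have h1 : c.dTot j.point (j.dPoint (j₀.dChartSymm p X)) = X.1 := by
    rw [Jet.dPoint_dChartSymm hp, hj, Jet.point_chartAt_symm hp]
    exact DFunLike.congr_fun (c.dTot_comp_dTotSymm hp) X.1
  -- In fibred coordinates the tangent map of the jet is `w ↦ (w, v w)`; this yields the term `p.2
  -- X.1.1`.
  have h2 := DFunLike.congr_fun (c.dTot_comp_tangent j hs)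
    (AdaptedChart.dProj π j.point (j.dPoint (j₀.dChartSymm p X)))
  have h3 := DFunLike.congr_fun (c.fst_comp_dTot hs) (j.dPoint (j₀.dChartSymm p X))
  simp only [ContinuousLinearMap.comp_apply, ContinuousLinearMap.coe_fst', h1] at h2 h3
  rw [← h3, Jet.velocity_chartAt_symm hp] at h2
  have h4 : j.contact (j₀.dChartSymm p X) = j.dPoint (j₀.dChartSymm p X) -
      j.tangent (AdaptedChart.dProj π j.point (j.dPoint (j₀.dChartSymm p X))) := rfl
  rw [h4, map_sub, h1, h2]
  rfl

/-- The velocity coordinates of a vertical element of `T_x^* M ⊗ V_e π`, as a function of the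
element. -/
def AdaptedChart.velocityLin (c : AdaptedChart π) (e : E) (z : R m) :
    (R m →L[ℝ] R (m + n)) →L[ℝ] (R m →L[ℝ] R n) :=
  (ContinuousLinearMap.compL ℝ (R m) (R (m + n)) (R n)
    ((ContinuousLinearMap.snd ℝ (R m) (R n)).comp (c.dTot e))).comp
    ((ContinuousLinearMap.compL ℝ (R m) (R m) (R (m + n))).flip (c.dBaseSymm z))

theorem AdaptedChart.velocityLin_apply (c : AdaptedChart π) (e : E) (z : R m)
    (u : R m →L[ℝ] R (m + n)) (w : R m) :
    c.velocityLin e z u w = (c.dTot e (u (c.dBaseSymm z w))).2 := rfl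

theorem AdaptedChart.velocity_translate (c : AdaptedChart π) (j : Jet π)
    (u : vertHom π j.point) : c.velocity (j.translate u) =
      c.velocity j + c.velocityLin j.point (c.base (π.proj j.point)) u.1 := by
  refine ContinuousLinearMap.ext fun w => ?_
  set b := c.dBaseSymm (c.base (π.proj j.point)) w with hb
  have h1 : c.velocity (j.translate u) w = (c.dTot j.point (j.tangent b + u.1 b)).2 := rfl
  have h2 : c.velocity j w = (c.dTot j.point (j.tangent b)).2 := rfl
  rw [h1, _root_.add_apply, h2, AdaptedChart.velocityLin_apply, map_add,
    Prod.snd_add]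

/-- In natural coordinates translation along the fibre of `J¹π → E` fixes `(x, y)` and adds a linear
function of `u` to `v`, so differentiating it gives the vertical lift at once. -/
theorem Jet.translate_eq (hp : p ∈ (chartAt (JetModel m n) j₀).target)
    (u : vertHom π ((chartAt (JetModel m n) j₀).symm p).point) :
    ((chartAt (JetModel m n) j₀).symm p).translate u = (chartAt (JetModel m n) j₀).symm
      (p.1, p.2 + j₀.fibredChart.velocityLin ((chartAt (JetModel m n) j₀).symm p).point
        p.1.1 u.1) := by
  have h0 := (chartAt (JetModel m n) j₀).right_inv hp
  have hs := (chartAt (JetModel m n) j₀).map_target hp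
  -- The type of `u` depends on the jet, so the jet becomes a variable and `p` is eliminated as its
  -- coordinates.
  generalize (chartAt (JetModel m n) j₀).symm p = j at *
  subst h0
  have h1 : j.translate u ∈ (chartAt (JetModel m n) j₀).source := hs
  rw [← (chartAt (JetModel m n) j₀).left_inv h1]
  congr 1
  refine Prod.ext rfl ?_
  refine (j₀.fibredChart.velocity_translate j u).trans ?_
  rw [← j₀.fibredChart.fst_tot _ hs]
  rfl

/-- The chain rule along `u ↦ (p.1, p.2 + A u)`, whose derivative is `(0, A)`. It is isolated for
abstract `f` and `g` so that no type depends on a jet. -/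
theorem mfderiv_comp_affine {F P Q N : Type*} [NormedAddCommGroup F] [NormedSpace ℝ F]
    (U : Submodule ℝ F) [NormedAddCommGroup P] [NormedSpace ℝ P] [NormedAddCommGroup Q] [NormedSpace ℝ Q]
    [TopologicalSpace N] [ChartedSpace (P × Q) N] {f : U → N} {g : P × Q → N} {p : P × Q}
    (A : F →L[ℝ] Q) (hf : ∀ u : U, f u = g (p.1, p.2 + A u.1))
    (hg : MDifferentiableAt 𝓘(ℝ, P × Q) 𝓘(ℝ, P × Q) g p) (u : U) :
    dMap (P × Q) f 0 u = dMap (P × Q) g p (0, A u.1) := by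
  have hT : HasFDerivAt (fun u : U => (p.1, p.2 + A u.1)) ((0 : U →L[ℝ] P).prod (A.comp U.subtypeL)) 0 :=
    (hasFDerivAt_const _ _).prodMk ((A.comp U.subtypeL).hasFDerivAt.const_add _)
  have hT0 : (fun u : U => (p.1, p.2 + A u.1)) 0 = p := by simp
  rw [← hT0] at hg
  have h3 := (hg.hasMFDerivAt.comp 0 hT.hasMFDerivAt).mfderiv
  rw [show (g ∘ fun u : U => (p.1, p.2 + A u.1)) = f from (funext hf).symm] at h3
  refine (DFunLike.congr_fun h3 u).trans ?_
  change dMap (P × Q) g ((fun u : U => (p.1, p.2 + A u.1)) 0) (0, A u.1) = _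
  rw [hT0]

/-- The coordinate expression of the vertical lift. -/
theorem Jet.vertLift_eq_dChartSymm (hp : p ∈ (chartAt (JetModel m n) j₀).target)
    (u : vertHom π ((chartAt (JetModel m n) j₀).symm p).point) :
    ((chartAt (JetModel m n) j₀).symm p).vertLift u = j₀.dChartSymm p
      (0, j₀.fibredChart.velocityLin ((chartAt (JetModel m n) j₀).symm p).point p.1.1 u.1) := by
  have htr := Jet.translate_eq hp
  have hd := Jet.mdifferentiableAt_chartAt_symm hp
  unfold Jet.vertLift Jet.dChartSymm
  generalize (chartAt (JetModel m n) j₀).symm p = j at *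
  exact mfderiv_comp_affine (vertHom π j.point) (j₀.fibredChart.velocityLin j.point p.1.1) htr hd u

/-- The coordinate expression of the vertical endomorphism. -/
theorem Jet.verticalEndo_eq_dChartSymm (hp : p ∈ (chartAt (JetModel m n) j₀).target)
    (a : R m →L[ℝ] ℝ) (X : JetModel m n) :
    ((chartAt (JetModel m n) j₀).symm p).verticalEndo
      (a.comp (j₀.fibredChart.dBase ((chartAt (JetModel m n) j₀).symm p).toBase))
      (j₀.dChartSymm p X) = j₀.dChartSymm p (0, a.smulRight (X.1.2 - p.2 X.1.1)) := by
  refine (Jet.vertLift_eq_dChartSymm hp _).trans ?_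
  congr 2
  refine ContinuousLinearMap.ext fun w => ?_
  have h1 := Jet.snd_dTot_contact hp X
  have h2 := DFunLike.congr_fun (j₀.fibredChart.dBase_comp_dBaseSymm
    (AdaptedChart.fst_mem_base_target _ (z := p.1) hp)) w
  rw [← Jet.toBase_chartAt_symm hp] at h2
  change (j₀.fibredChart.dTot ((chartAt (JetModel m n) j₀).symm p).point
    (a (j₀.fibredChart.dBase ((chartAt (JetModel m n) j₀).symm p).toBase
      (j₀.fibredChart.dBaseSymm p.1.1 w)) •
      (((chartAt (JetModel m n) j₀).symm p).contact (j₀.dChartSymm p X) : R (m + n)))).2 = _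
  rw [map_smul, Prod.smul_snd, h1]
  change a ((j₀.fibredChart.dBase _ ∘SL j₀.fibredChart.dBaseSymm p.1.1) w) • _ = _
  rw [h2]
  rfl

end JetCharts

/-! ### Coordinate expression, smoothness and vanishing of the Poincaré–Cartan forms. -/

section PoincareCartan

open Filter Topology

variable {m n : ℕ} {M E : Type*} [TopologicalSpace M] [ChartedSpace (R m) M]
  [TopologicalSpace E] [ChartedSpace (R (m + n)) E]
  {π : FibredManifold m n M E} {j₀ : Jet π} {p : JetModel m n}

/-- The identity tensor `∑ e^μ ⊗ e_μ` takes `B` on either factor. This makes the basis used in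
`momentumMap` irrelevant, although it comes from the preferred charts of `M` and not from the fibred
coordinates. -/
theorem sum_proj_comp_smul_single (G : (R m →L[ℝ] ℝ) →ₗ[ℝ] ℝ) (B : R m →L[ℝ] R m) :
    ∑ μ, G ((EuclideanSpace.proj μ : R m →L[ℝ] ℝ).comp B) • (EuclideanSpace.single μ 1 : R m) =
      B (∑ ν, G (EuclideanSpace.proj ν) • EuclideanSpace.single ν 1) := by
  have h1 : ∀ μ, (EuclideanSpace.proj μ : R m →L[ℝ] ℝ).comp B =
      ∑ ν, (B (EuclideanSpace.single ν 1)) μ • (EuclideanSpace.proj ν : R m →L[ℝ] ℝ) := by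
    intro μ
    refine ContinuousLinearMap.ext fun x => ?_
    have hx : x = ∑ ν, x ν • (EuclideanSpace.single ν 1 : R m) := by
      ext i
      simp [Finset.sum_apply, Pi.single_apply]
    have h2 : (B x) μ = ∑ ν, x ν * (B (EuclideanSpace.single ν 1)) μ := by
      conv_lhs => rw [hx]
      simp [map_sum]
    rw [_root_.sum_apply]
    simp [h2, mul_comm]
  ext μ
  simp only [h1, map_sum, map_smul]
  simp [Finset.sum_apply, Pi.single_apply, mul_comm]

/-- The previous formula for covectors that are not given in the base coordinates: `a` is written as
`(a ∘ dBaseSymm) ∘ dBase`. -/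
theorem Jet.verticalEndo_dChartSymm (hp : p ∈ (chartAt (JetModel m n) j₀).target)
    (a : R m →L[ℝ] ℝ) (X : JetModel m n) :
    ((chartAt (JetModel m n) j₀).symm p).verticalEndo a (j₀.dChartSymm p X) =
      j₀.dChartSymm p
        (0, (a.comp (j₀.fibredChart.dBaseSymm p.1.1)).smulRight (X.1.2 - p.2 X.1.1)) := by
  have h2 := j₀.fibredChart.dBaseSymm_comp_dBase
    (j₀.fibredChart.proj_mem _ ((chartAt (JetModel m n) j₀).map_target hp))
  have h3 : j₀.fibredChart.base (π.proj ((chartAt (JetModel m n) j₀).symm p).point) = p.1.1 := by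
    rw [← j₀.fibredChart.fst_tot _ ((chartAt (JetModel m n) j₀).map_target hp)]
    exact congrArg (fun q : JetModel m n => q.1.1) ((chartAt (JetModel m n) j₀).right_inv hp)
  rw [h3] at h2
  have h4 : (a.comp (j₀.fibredChart.dBaseSymm p.1.1)).comp
      (j₀.fibredChart.dBase ((chartAt (JetModel m n) j₀).symm p).toBase) = a := by
    rw [ContinuousLinearMap.comp_assoc]
    exact (congrArg a.comp h2).trans a.comp_id
  refine Eq.trans ?_ (Jet.verticalEndo_eq_dChartSymm hp _ X)
  exact congrArg (fun b : R m →L[ℝ] ℝ =>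
    ((chartAt (JetModel m n) j₀).symm p).verticalEndo b (j₀.dChartSymm p X)) h4.symm

/-- The coordinate expression `∂L/∂v^A_ν (dy^A - v^A_α dx^α) ⊗ ∂/∂x^ν`. -/
def momentumCoord (L : Jet π → ℝ) (j₀ : Jet π) (p X : JetModel m n) : R m :=
  ∑ ν : Fin m, fderiv ℝ (L ∘ (chartAt (JetModel m n) j₀).symm) p
    (0, (EuclideanSpace.proj ν : R m →L[ℝ] ℝ).smulRight (X.1.2 - p.2 X.1.1)) •
      (EuclideanSpace.single ν 1 : R m)

variable {L : Jet π → ℝ} {η : DForm (R m) M m}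

theorem momentumMap_dChartSymm (hL : ContMDiff 𝓘(ℝ, JetModel m n) 𝓘(ℝ, ℝ) ∞ L)
    (hp : p ∈ (chartAt (JetModel m n) j₀).target) (X : JetModel m n) :
    momentumMap L ((chartAt (JetModel m n) j₀).symm p) (j₀.dChartSymm p X) =
      j₀.fibredChart.dBaseSymm p.1.1 (momentumCoord L j₀ p X) := by
  have h1 := mfderiv_comp p (hL.mdifferentiableAt (by simp))
    (Jet.mdifferentiableAt_chartAt_symm hp)
  rw [mfderiv_eq_fderiv] at h1
  -- `G` sends a covector `a` to the derivative of `L` along the vertical direction `a ⊗ (dy - v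
  -- dx)(X)`; linearity in `a` is what the change of basis needs.
  let G : (R m →L[ℝ] ℝ) →ₗ[ℝ] ℝ :=
    { toFun := fun a => fderiv ℝ (L ∘ (chartAt (JetModel m n) j₀).symm) p
        (0, a.smulRight (X.1.2 - p.2 X.1.1))
      map_add' := fun a b => by
        rw [← map_add, Prod.mk_add_mk, add_zero]
        congr 2
        ext w
        simp [add_smul]
      map_smul' := fun r a => by
        rw [RingHom.id_apply, ← map_smul, Prod.smul_mk, smul_zero]
        congr 2
        ext w
        simp [mul_smul] }
  refine Eq.trans ?_ (sum_proj_comp_smul_single G (j₀.fibredChart.dBaseSymm p.1.1))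
  obtain ⟨dL, hdL⟩ : ∃ dL : JetModel m n →L[ℝ] ℝ, dL =
    mfderiv 𝓘(ℝ, JetModel m n) 𝓘(ℝ, ℝ) L ((chartAt (JetModel m n) j₀).symm p) := ⟨_, rfl⟩
  have h2 : momentumMap L ((chartAt (JetModel m n) j₀).symm p) (j₀.dChartSymm p X) =
      ∑ μ : Fin m, dL (((chartAt (JetModel m n) j₀).symm p).verticalEndo
          (EuclideanSpace.proj μ : R m →L[ℝ] ℝ) (j₀.dChartSymm p X)) •
        (EuclideanSpace.single μ 1 : R m) := by
    subst hdL
    exact _root_.sum_apply _ _ _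
  rw [h2]
  refine Finset.sum_congr rfl fun μ _ => ?_
  rw [Jet.verticalEndo_dChartSymm hp]
  congr 1
  subst hdL
  exact (DFunLike.congr_fun h1 _).symm

theorem contractVerticalEndo_inChart (hL : ContMDiff 𝓘(ℝ, JetModel m n) 𝓘(ℝ, ℝ) ∞ L)
    (hp : p ∈ (chartAt (JetModel m n) j₀).target) (v : Fin m → JetModel m n) :
    (contractVerticalEndo η L).inChart j₀ p v =
      ∑ S ∈ Finset.powersetCard 1 (Finset.univ : Finset (Fin m)),
        η.pull j₀.fibredChart.base.symm p.1.1
          fun i => if i ∈ S then momentumCoord L j₀ p (v i) else (v i).1.1 := by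
  refine (mixedPart_apply 1 (η ((chartAt (JetModel m n) j₀).symm p).toBase) _ _
    fun i => j₀.dChartSymm p (v i)).trans ?_
  refine Finset.sum_congr rfl fun S _ => ?_
  rw [DForm.pull_apply]
  refine η.apply_congr (Jet.toBase_chartAt_symm hp) (funext fun i => ?_)
  split_ifs
  · exact momentumMap_dChartSymm hL hp (v i)
  · exact Jet.dToBase_dChartSymm hp (v i)

theorem lagrangianDensity_inChart (hp : p ∈ (chartAt (JetModel m n) j₀).target)
    (v : Fin m → JetModel m n) :
    (lagrangianDensity η L).inChart j₀ p v = L ((chartAt (JetModel m n) j₀).symm p) *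
      η.pull j₀.fibredChart.base.symm p.1.1 fun i => (v i).1.1 := by
  refine congrArg (L ((chartAt (JetModel m n) j₀).symm p) * ·) ?_
  rw [DForm.pull_apply]
  exact η.apply_congr (Jet.toBase_chartAt_symm hp)
    (funext fun i => Jet.dToBase_dChartSymm hp (v i))

/-- All slots but at most one see only the `x`-component of their vector. Both the smoothness of
`Θ_ℒ` and its vanishing on two vertical vectors are read off from this formula. -/
theorem poincareCartanTheta_inChart (hL : ContMDiff 𝓘(ℝ, JetModel m n) 𝓘(ℝ, ℝ) ∞ L)
    (hp : p ∈ (chartAt (JetModel m n) j₀).target) (v : Fin m → JetModel m n) :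
    (poincareCartanTheta η L).inChart j₀ p v =
      ∑ S ∈ Finset.powersetCard 1 (Finset.univ : Finset (Fin m)),
        η.pull j₀.fibredChart.base.symm p.1.1
          (fun i => if i ∈ S then momentumCoord L j₀ p (v i) else (v i).1.1) +
      L ((chartAt (JetModel m n) j₀).symm p) *
        η.pull j₀.fibredChart.base.symm p.1.1 fun i => (v i).1.1 := by
  rw [← contractVerticalEndo_inChart hL hp, ← lagrangianDensity_inChart hp]
  rfl

theorem contDiffAt_comp_chartAt_symm (hL : ContMDiff 𝓘(ℝ, JetModel m n) 𝓘(ℝ, ℝ) ∞ L)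
    (hp : p ∈ (chartAt (JetModel m n) j₀).target) :
    ContDiffAt ℝ ∞ (L ∘ (chartAt (JetModel m n) j₀).symm) p :=
  contMDiffAt_iff_contDiffAt.1 (hL.contMDiffAt.comp p (contMDiffAt_chartAt_symm hp))

theorem contDiffAt_momentumCoord (hL : ContMDiff 𝓘(ℝ, JetModel m n) 𝓘(ℝ, ℝ) ∞ L)
    (hp : p ∈ (chartAt (JetModel m n) j₀).target) (X : JetModel m n) :
    ContDiffAt ℝ ∞ (fun q => momentumCoord L j₀ q X) p := by
  refine ContDiffAt.sum fun ν _ => ContDiffAt.fun_smul ?_ contDiffAt_const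
  refine ((contDiffAt_comp_chartAt_symm hL hp).fderiv_right (m := ∞) (by simp)).clm_apply ?_
  refine contDiffAt_const.prodMk ?_
  refine (ContinuousLinearMap.smulRightL ℝ (R m) (R n)
    (EuclideanSpace.proj ν : R m →L[ℝ] ℝ)).contDiff.contDiffAt.comp p ?_
  exact contDiffAt_const.sub (contDiffAt_snd.clm_apply contDiffAt_const)

/-- The Poincaré–Cartan `m`-form is smooth. -/
theorem isSmooth_poincareCartanTheta [IsManifold (𝓡 m) ∞ M] (hη : η.IsSmooth)
    (hL : ContMDiff 𝓘(ℝ, JetModel m n) 𝓘(ℝ, ℝ) ∞ L) : (poincareCartanTheta η L).IsSmooth := by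
  refine DForm.isSmooth_of_apply fun j₀ p hp v => ?_
  have ho : ∀ᶠ q in 𝓝 p, q ∈ (chartAt (JetModel m n) j₀).target :=
    (chartAt (JetModel m n) j₀).open_target.mem_nhds hp
  refine ContDiffAt.congr_of_eventuallyEq ?_
    (ho.mono fun q hq => poincareCartanTheta_inChart hL hq v)
  have hg : ContMDiffAt (𝓡 m) (𝓡 m) ∞ j₀.fibredChart.base.symm p.1.1 :=
    j₀.fibredChart.smooth_base_symm.contMDiffAt (j₀.fibredChart.base.open_target.mem_nhds
      (j₀.fibredChart.fst_mem_base_target (z := p.1) hp))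
  have hf : ContDiffAt ℝ ∞ (fun q : JetModel m n => q.1.1) p :=
    contDiffAt_fst.comp p contDiffAt_fst
  have h1 : ContDiffAt ℝ ∞
      (fun q : JetModel m n => η.pull j₀.fibredChart.base.symm q.1.1) p :=
    ContDiffAt.comp (g := η.pull j₀.fibredChart.base.symm) (f := fun q : JetModel m n => q.1.1) p
      (hη.contDiffAt_pull hg) hf
  refine ContDiffAt.add (ContDiffAt.sum fun S _ => ?_) (ContDiffAt.mul ?_ ?_)
  · refine contDiffAt_alternating_apply
      (u := fun i q => if i ∈ S then momentumCoord L j₀ q (v i) else (v i).1.1) h1 fun i => ?_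
    by_cases hi : i ∈ S
    · simpa only [hi, if_true] using contDiffAt_momentumCoord hL hp (v i)
    · simpa only [hi, if_false] using contDiffAt_const
  · exact contDiffAt_comp_chartAt_symm hL hp
  · exact contDiffAt_alternating_apply (u := fun i _ => (v i).1.1) h1 fun i => contDiffAt_const

theorem isSmooth_poincareCartanOmega [IsManifold (𝓡 m) ∞ M] (hη : η.IsSmooth)
    (hL : ContMDiff 𝓘(ℝ, JetModel m n) 𝓘(ℝ, ℝ) ∞ L) : (poincareCartanOmega η L).IsSmooth :=
  (isSmooth_poincareCartanTheta hη hL).extDeriv.neg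

/-- The Poincaré–Cartan `m`-form vanishes on two vertical vectors. -/
theorem poincareCartanTheta_inChart_eq_zero (hL : ContMDiff 𝓘(ℝ, JetModel m n) 𝓘(ℝ, ℝ) ∞ L)
    (hp : p ∈ (chartAt (JetModel m n) j₀).target) {v : Fin m → JetModel m n} {a b : Fin m}
    (hab : a ≠ b) (ha : (v a).1.1 = 0) (hb : (v b).1.1 = 0) :
    (poincareCartanTheta η L).inChart j₀ p v = 0 := by
  rw [poincareCartanTheta_inChart hL hp,
    (η.pull j₀.fibredChart.base.symm p.1.1).map_coord_zero a ha, mul_zero, add_zero]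
  refine Finset.sum_eq_zero fun S hS => ?_
  obtain ⟨c, rfl⟩ := Finset.card_eq_one.1 (Finset.mem_powersetCard.1 hS).2
  -- The momentum occupies the single slot `c`, so at least one of the vertical slots `a`, `b` still
  -- carries a zero `x`-component.
  by_cases hc : a = c
  · exact ContinuousAlternatingMap.map_coord_zero _ b (by simp [hb, ← hc, hab.symm])
  · exact ContinuousAlternatingMap.map_coord_zero _ a (by simp [ha, hc])

/-- This turns verticality into the chart condition, independent of the point, that the exterior
derivative argument requires. -/
theorem Jet.fst_fst_mfderiv_chartAt (y : Jet π) (X : JetModel m n) (hX : y.dToBase X = 0) :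
    (mfderiv 𝓘(ℝ, JetModel m n) 𝓘(ℝ, JetModel m n) (chartAt (JetModel m n) y) y X :
      JetModel m n).1.1 = 0 := by
  have hy := mem_chart_source (JetModel m n) y
  have hf : HasMFDerivAt 𝓘(ℝ, JetModel m n) (𝓡 m)
      (fun q : JetModel m n => q.1.1) (chartAt (JetModel m n) y y)
      ((ContinuousLinearMap.fst ℝ (R m) (R n)).comp
        (ContinuousLinearMap.fst ℝ (R m × R n) (R m →L[ℝ] R n))) :=
    ((ContinuousLinearMap.fst ℝ (R m) (R n)).comp
      (ContinuousLinearMap.fst ℝ (R m × R n) (R m →L[ℝ] R n))).hasFDerivAt.hasMFDerivAt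
  have h1 := hf.comp y ((contMDiffAt_chartAt hy).mdifferentiableAt (by simp)).hasMFDerivAt
  have h2 := (y.fibredChart.mdiff_base (y.fibredChart.proj_mem _ hy)).hasMFDerivAt.comp y
    (Jet.contMDiff_toBase.mdifferentiableAt (by simp)).hasMFDerivAt
  have h3 : (fun q : JetModel m n => q.1.1) ∘ chartAt (JetModel m n) y =ᶠ[𝓝 y]
      y.fibredChart.base ∘ Jet.toBase := by
    filter_upwards [(chartAt (JetModel m n) y).open_source.mem_nhds hy] with j hj
    exact y.fibredChart.fst_tot _ hj
  have h4 := DFunLike.congr_fun (hasMFDerivAt_unique (h1.congr_of_eventuallyEq h3.symm) h2) X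
  refine h4.trans ?_
  change y.fibredChart.dBase y.toBase (y.dToBase X) = 0
  rw [hX, map_zero]

/-- The Poincaré–Cartan `(m+1)`-form vanishes on three vertical vectors. -/
theorem poincareCartanOmega_eq_zero [IsManifold (𝓡 m) ∞ M] (hη : η.IsSmooth)
    (hL : ContMDiff 𝓘(ℝ, JetModel m n) 𝓘(ℝ, ℝ) ∞ L) (y : Jet π)
    (v : Fin (m + 1) → TangentSpace 𝓘(ℝ, JetModel m n) y) {i j k : Fin (m + 1)} (hij : i ≠ j)
    (hik : i ≠ k) (hjk : j ≠ k)
    (hv : ∀ l ∈ ({i, j, k} : Set (Fin (m + 1))), y.dToBase (v l) = 0) :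
    poincareCartanOmega η L y v = 0 := by
  have key := (isSmooth_poincareCartanTheta hη hL).extDeriv_apply_eq_zero
    (P := fun X : JetModel m n => X.1.1 = 0) (y := y)
    (fun z hz v a b hab ha hb => poincareCartanTheta_inChart_eq_zero hL hz hab ha hb)
    v hij hik hjk fun l hl => y.fst_fst_mfderiv_chartAt (v l) (hv l hl)
  exact (congrArg (fun t : ℝ => -t) key).trans neg_zero

end PoincareCartan

/-! ### Pointwise decomposition with respect to a horizontal lift. -/

section ConnectionAlgebra

variable {T : Type*} [AddCommGroup T] [Module ℝ T] [TopologicalSpace T] {m : ℕ}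

/-- `m + 1` vectors of `ℝᵐ` are linearly dependent. This excludes bidegree `(m + 1, 0)`. -/
theorem apply_lift_eq_zero (α : T [⋀^Fin (m + 1)]→L[ℝ] ℝ) (l : R m →L[ℝ] T)
    (x : Fin (m + 1) → R m) : α (fun i => l (x i)) = 0 := by
  refine (α.toAlternatingMap.compLinearMap l.toLinearMap).map_linearDependent x fun h => ?_
  simpa using h.fintype_card_le_finrank

/-- Moving the last argument to the front is a cycle of length `m + 1`, of sign `(-1)^m`; this
accounts for the sign in `contract`. -/
theorem apply_snoc (α : T [⋀^Fin (m + 1)]→L[ℝ] ℝ) (w : Fin m → T) (u : T) :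
    α (Fin.snoc (α := fun _ => T) w u) = (-1 : ℝ) ^ m * α (Matrix.vecCons u w) := by
  have h1 := α.toAlternatingMap.map_perm (Matrix.vecCons u w) (finRotate (m + 1))
  rw [sign_finRotate, Nat.add_sub_cancel] at h1
  have h2 : (Fin.snoc (α := fun _ => T) w u) = Matrix.vecCons u w ∘ finRotate (m + 1) :=
    Fin.snoc_eq_cons_rotate _ _
  rw [h2]
  refine h1.trans ?_
  simp [Units.smul_def]

section

variable [IsTopologicalAddGroup T] [ContinuousSMul ℝ T] [T2Space T] [FiniteDimensional ℝ T]

theorem contract_map_apply (α : T [⋀^Fin (m + 1)]→L[ℝ] ℝ) (l : R m →L[ℝ] T) (c : ℝ)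
    (b : Fin m → R m) (u : Fin 1 → T) :
    contract (exteriorPower.map m l.toLinearMap (c • exteriorPower.ιMulti ℝ m b)) α u =
      c * α (Fin.snoc (α := fun _ => T) (fun i => l (b i)) (u 0)) := by
  rw [apply_snoc]
  change (-1 : ℝ) ^ m * exteriorPower.alternatingMapLinearEquiv
    (α.toAlternatingMap.curryLeft (u 0))
    (exteriorPower.map m l.toLinearMap (c • exteriorPower.ιMulti ℝ m b)) = _
  rw [map_smul, map_smul, exteriorPower.map_apply_ιMulti,
    exteriorPower.alternatingMapLinearEquiv_apply_ιMulti, smul_eq_mul]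
  change (-1 : ℝ) ^ m * (c * α (Matrix.vecCons (u 0) (fun i => l (b i)))) = _
  ring

/-- For fixed `u`, the form `x ↦ α(u, l x₁, …, l x_m)` on `ℝᵐ` has top degree, hence is proportional
to `η`. The vectors `x` are arbitrary, so the contraction can be computed in any frame. -/
theorem mul_contract_map_apply (α : T [⋀^Fin (m + 1)]→L[ℝ] ℝ) (l : R m →L[ℝ] T)
    {η : R m [⋀^Fin m]→L[ℝ] ℝ} (hη : η ≠ 0) (x : Fin m → R m) (u : Fin 1 → T) :
    η x * contract (exteriorPower.map m l.toLinearMap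
      ((η fun μ => EuclideanSpace.single μ 1)⁻¹ •
        exteriorPower.ιMulti ℝ m fun μ => EuclideanSpace.single μ 1)) α u =
      α (Fin.snoc (α := fun _ => T) (fun i => l (x i)) (u 0)) := by
  let b := (EuclideanSpace.basisFun (Fin m) ℝ).toBasis
  have hb : ⇑b = fun μ => EuclideanSpace.single μ 1 := by
    funext μ
    simp [b]
  have h0 : η b ≠ 0 := fun h => hη (ContinuousAlternatingMap.toAlternatingMap_injective
    ((AlternatingMap.map_basis_eq_zero_iff b η.toAlternatingMap).1 h))
  have h1 := apply_mul_apply_basis b η.toAlternatingMap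
    ((α.toAlternatingMap.curryLeft (u 0)).compLinearMap l.toLinearMap) x
  change η x * α (Matrix.vecCons (u 0) (fun i => l (b i))) =
    α (Matrix.vecCons (u 0) (fun i => l (x i))) * η b at h1
  simp only [hb] at h0 h1
  rw [contract_map_apply, apply_snoc, apply_snoc]
  field_simp
  linear_combination h1

/-- The component of bidegree `(m, 1)` of a form is the product of the pullback of a volume form and
the contraction of the form with the lift of its dual `m`-vector. -/
theorem wedge_contract_eq_mixedPart (α : T [⋀^Fin (m + 1)]→L[ℝ] ℝ) {l : R m →L[ℝ] T}
    {d : T →L[ℝ] R m} {A B : T →L[ℝ] T} (hA : ∀ v, A v = l (d v)) (hB : ∀ v, B v = v - l (d v))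
    {η : R m [⋀^Fin m]→L[ℝ] ℝ} (hη : η ≠ 0) :
    wedge (η.compContinuousLinearMap d).toAlternatingMap
      (contract (exteriorPower.map m l.toLinearMap
        ((η fun μ => EuclideanSpace.single μ 1)⁻¹ •
          exteriorPower.ιMulti ℝ m fun μ => EuclideanSpace.single μ 1)) α).toAlternatingMap =
      (mixedPart m α A B).toAlternatingMap := by
  refine wedge_one_eq_mixedPart _ _ α A B fun v => ?_
  refine (mul_contract_map_apply α l hη (fun i => d (v i.castSucc)) _).trans ?_
  have h1 : ∀ z : T, (fun i => if i = Fin.last m then z else A (v i)) =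
      Function.update (fun i => A (v i)) (Fin.last m) z := by
    intro z
    funext i
    by_cases hi : i = Fin.last m
    · subst hi; simp
    · simp [hi]
  have h2 : (Fin.snoc (α := fun _ => T) (fun i => l (d (v i.castSucc))) (v (Fin.last m))) =
      Function.update (fun i => A (v i)) (Fin.last m) (v (Fin.last m)) := by
    funext i
    refine Fin.lastCases ?_ (fun j => ?_) i
    · simp
    · simp [hA, Fin.castSucc_ne_last]
  have h3 : (fun i => if i = Fin.last m then B (v i) else A (v i)) =
      Function.update (fun i => A (v i)) (Fin.last m) (B (v (Fin.last m))) := by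
    rw [← h1]
    funext i
    by_cases hi : i = Fin.last m <;> simp [hi]
  rw [h2, h3, hB]
  have h4 := α.toAlternatingMap.map_update_sub (fun i => A (v i)) (Fin.last m)
    (v (Fin.last m)) (l (d (v (Fin.last m))))
  -- The last argument may be replaced by its vertical part: its horizontal part would give `m + 1`
  -- lifted vectors.
  have h5 : α (Function.update (fun i => A (v i)) (Fin.last m) (l (d (v (Fin.last m))))) = 0 := by
    rw [← hA, Function.update_eq_self (Fin.last m) (fun i => A (v i))]
    simp only [hA]
    exact apply_lift_eq_zero α l _
  refine Eq.trans ?_ h4.symm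
  refine Eq.symm ((congrArg (_ - ·) h5).trans (sub_zero _))

end

/-- A form of degree `m + 1` that vanishes on three vertical vectors has components of bidegrees
`(m, 1)` and `(m - 1, 2)` only. -/
theorem sub_mixedPart_eq_mixedPart [IsTopologicalAddGroup T] (hm : 1 ≤ m)
    (α : T [⋀^Fin (m + 1)]→L[ℝ] ℝ) {l : R m →L[ℝ] T}
    {d : T →L[ℝ] R m} {A B : T →L[ℝ] T} (hA : ∀ v, A v = l (d v)) (hB : ∀ v, B v = v - l (d v))
    (hdl : ∀ w, d (l w) = w)
    (h3 : ∀ (v : Fin (m + 1) → T) (i j k : Fin (m + 1)), i ≠ j → i ≠ k → j ≠ k →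
      (∀ r ∈ ({i, j, k} : Set (Fin (m + 1))), d (v r) = 0) → α v = 0) :
    α - mixedPart m α A B = mixedPart (m - 1) α A B := by
  have hsum := eq_sum_mixedPart α (A := A) (B := B) fun v => by rw [hA, hB]; abel
  -- From here `m + 1` is the dimension of the base and `m + 2` the degree of the form; the
  -- component wanted on the right is the one with `m` horizontal slots.
  obtain ⟨m, rfl⟩ := Nat.exists_eq_add_of_le' hm
  ext v
  have h1 : mixedPart (m + 1 + 1) α A B = 0 := by
    ext w
    rw [mixedPart_apply]
    refine Finset.sum_eq_zero fun S hS => ?_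
    have : S = Finset.univ := Finset.eq_univ_of_card S
      (by rw [(Finset.mem_powersetCard.1 hS).2, Fintype.card_fin])
    subst this
    simp only [Finset.mem_univ, if_true, hA]
    exact apply_lift_eq_zero α l _
  -- Fewer than `m` horizontal slots among `m + 2` leave at least three vertical ones.
  have h2 : ∀ p < m, mixedPart p α A B = 0 := by
    intro p hp
    refine mixedPart_eq_zero (q := 3) α (fun S v hS hv => ?_) (by omega)
    obtain ⟨i, j, k, hij, hik, hjk, rfl⟩ := Finset.card_eq_three.1 hS
    refine h3 v i j k hij hik hjk fun r hr => ?_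
    obtain ⟨u, hu⟩ := hv r (by simpa using hr)
    rw [hu, hB, map_sub, hdl, sub_self]
  have h4 := hsum v
  rw [Finset.sum_range_succ, Finset.sum_range_succ, Finset.sum_range_succ,
    Finset.sum_eq_zero fun p hp => by rw [h2 p (Finset.mem_range.1 hp)]; rfl, h1] at h4
  change α v - mixedPart (m + 1) α A B v = mixedPart m α A B v
  rw [h4]
  change 0 + _ + _ + 0 - _ = _
  ring

end ConnectionAlgebra

/-! ### Connections in charts and smoothness of the bidegree components. -/

section ConnectionForms

open Filter Topology

theorem eventually_mem_source {V W N Q : Type*} [NormedAddCommGroup V] [NormedAddCommGroup W]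
    [TopologicalSpace N] [ChartedSpace V N] [TopologicalSpace Q] [ChartedSpace W Q] {κ : N → Q}
    (hκ : Continuous κ) (y₀ : N) :
    ∀ᶠ z in 𝓝 (chartAt V y₀ y₀), z ∈ (chartAt V y₀).target ∧
      κ ((chartAt V y₀).symm z) ∈ (chartAt W (κ y₀)).source := by
  have hz := mem_chart_target V y₀
  have h0 : ∀ᶠ z in 𝓝 (chartAt V y₀ y₀), z ∈ (chartAt V y₀).target :=
    (chartAt V y₀).open_target.mem_nhds hz
  refine h0.and ?_
  have h1 := (chartAt V y₀).continuousAt_symm hz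
  have h2 := (hκ.continuousAt.comp h1).preimage_mem_nhds (t := (chartAt W (κ y₀)).source) (by
    rw [Function.comp_apply, (chartAt V y₀).left_inv (mem_chart_source V y₀)]
    exact (chartAt W (κ y₀)).open_source.mem_nhds (mem_chart_source W _))
  exact h2

variable {V W : Type*} [NormedAddCommGroup V] [NormedSpace ℝ V] [NormedAddCommGroup W]
  [NormedSpace ℝ W] {N Q : Type*} [TopologicalSpace N] [ChartedSpace V N] [TopologicalSpace Q]
  [ChartedSpace W Q] [IsManifold 𝓘(ℝ, V) ∞ N] [IsManifold 𝓘(ℝ, W) ∞ Q] {κ : N → Q} {k : ℕ}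

theorem dMap_chartAt_symm_mfderiv {y₀ y : N} (hy : y ∈ (chartAt V y₀).source) (X : V) :
    dMap V (chartAt V y₀).symm (chartAt V y₀ y)
      (mfderiv 𝓘(ℝ, V) 𝓘(ℝ, V) (chartAt V y₀) y X) = X := by
  have h1 := mfderiv_comp y
    ((contMDiffAt_chartAt_symm ((chartAt V y₀).map_source hy)).mdifferentiableAt (by simp))
    ((contMDiffAt_chartAt hy).mdifferentiableAt (by simp))
  have h2 : (chartAt V y₀).symm ∘ chartAt V y₀ =ᶠ[𝓝 y] id :=
    Filter.eventuallyEq_of_mem ((chartAt V y₀).open_source.mem_nhds hy)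
      fun x hx => (chartAt V y₀).left_inv hx
  exact DFunLike.congr_fun (h1.symm.trans (h2.mfderiv_eq.trans mfderiv_id)) X

namespace EhresmannConnection

variable (C : EhresmannConnection (V := V) (W := W) κ)

/-- The horizontal lift, read in the preferred charts at `y₀` and `κ y₀`. -/
def coordLift (y₀ : N) (z : V) : W →L[ℝ] V :=
  inTangentCoordinates 𝓘(ℝ, W) 𝓘(ℝ, V) κ id C.lift y₀ ((chartAt V y₀).symm z)

/-- The horizontal projection, read in the preferred chart at `y₀`. -/
def coordHor (y₀ : N) (z : V) : V →L[ℝ] V :=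
  (C.coordLift y₀ z).comp (fderiv ℝ (chartAt W (κ y₀) ∘ (κ ∘ (chartAt V y₀).symm)) z)

/-- The horizontal lift, read in the model spaces. -/
def liftMap (y : N) : W →L[ℝ] V := C.lift y

theorem contDiffAt_coordLift (y₀ : N) :
    ContDiffAt ℝ ∞ (C.coordLift y₀) (chartAt V y₀ y₀) :=
  contMDiffAt_iff_contDiffAt.1 (ContMDiffAt.comp_of_eq (C.smooth y₀)
    (contMDiffAt_chartAt_symm (mem_chart_target V y₀))
    ((chartAt V y₀).left_inv (mem_chart_source V y₀)))

variable {C}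

/-- `inTangentCoordinates` is composition with the derivatives of the two charts, so near the centre
the differentials of the inverse charts intertwine `coordLift` with the actual lift. -/
theorem dMap_coordLift {y₀ : N} {z : V} (hz : z ∈ (chartAt V y₀).target)
    (hκz : κ ((chartAt V y₀).symm z) ∈ (chartAt W (κ y₀)).source) (w : W) :
    dMap V (chartAt V y₀).symm z (C.coordLift y₀ z w) = C.liftMap ((chartAt V y₀).symm z)
      (dMap W (chartAt W (κ y₀)).symm (chartAt W (κ y₀) (κ ((chartAt V y₀).symm z))) w) := by
  have hs := (chartAt V y₀).map_target hz
  have h1 := inTangentCoordinates_eq_mfderiv_comp (I := 𝓘(ℝ, W)) (I' := 𝓘(ℝ, V)) (f := κ)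
    (g := id) (ϕ := C.lift) (x₀ := y₀) (x := (chartAt V y₀).symm z) hκz hs
  have h2 := dMap_chartAt_symm_mfderiv hs (C.liftMap ((chartAt V y₀).symm z)
      (dMap W (chartAt W (κ y₀)).symm (chartAt W (κ y₀) (κ ((chartAt V y₀).symm z))) w))
  rw [(chartAt V y₀).right_inv hz] at h2
  refine Eq.trans ?_ h2
  congr 1
  refine (DFunLike.congr_fun h1 w).trans ?_
  simp only [mfld_simps, mfderivWithin_univ]
  rfl

/-- With this intertwining, projecting the arguments of a form and pulling it back to the chart can
be done in either order. -/
theorem dMap_coordHor (hκ : ContMDiff 𝓘(ℝ, V) 𝓘(ℝ, W) ∞ κ) {y₀ : N} {z : V}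
    (hz : z ∈ (chartAt V y₀).target)
    (hκz : κ ((chartAt V y₀).symm z) ∈ (chartAt W (κ y₀)).source) (X : V) :
    dMap V (chartAt V y₀).symm z (C.coordHor y₀ z X) =
      C.horProj ((chartAt V y₀).symm z) (dMap V (chartAt V y₀).symm z X) := by
  refine (dMap_coordLift hz hκz _).trans ?_
  have h1 := mfderiv_comp z ((contMDiffAt_chartAt hκz).mdifferentiableAt (by simp))
    ((hκ.contMDiffAt.comp z (contMDiffAt_chartAt_symm hz)).mdifferentiableAt (by simp))
  have h2 := mfderiv_comp z (hκ.contMDiffAt.mdifferentiableAt (by simp))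
    ((contMDiffAt_chartAt_symm hz).mdifferentiableAt (by simp))
  rw [mfderiv_eq_fderiv] at h1
  have h3 := (DFunLike.congr_fun h1 X)
  have h4 := (DFunLike.congr_fun h2 X)
  refine congrArg (C.liftMap ((chartAt V y₀).symm z)) ?_
  exact (congrArg (dMap W (chartAt W (κ y₀)).symm
    (chartAt W (κ y₀) (κ ((chartAt V y₀).symm z)))) h3).trans
      ((dMap_chartAt_symm_mfderiv hκz _).trans h4)

theorem contDiffAt_coordHor (hκ : ContMDiff 𝓘(ℝ, V) 𝓘(ℝ, W) ∞ κ) (y₀ : N) :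
    ContDiffAt ℝ ∞ (C.coordHor y₀) (chartAt V y₀ y₀) := by
  have hz := mem_chart_target V y₀
  have h1 : ContDiffAt ℝ ∞ (chartAt W (κ y₀) ∘ (κ ∘ (chartAt V y₀).symm)) (chartAt V y₀ y₀) := by
    refine contDiffAt_chartAt_comp (hκ.contMDiffAt.comp _ (contMDiffAt_chartAt_symm hz)) ?_
    rw [Function.comp_apply, (chartAt V y₀).left_inv (mem_chart_source V y₀)]
    exact mem_chart_source W _
  exact (C.contDiffAt_coordLift y₀).clm_comp (h1.fderiv_right (m := ∞) (by simp))

/-- The components of a smooth form with respect to a connection are smooth. -/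
theorem isSmooth_bidegreePart [FiniteDimensional ℝ V] (hκ : ContMDiff 𝓘(ℝ, V) 𝓘(ℝ, W) ∞ κ)
    {α : DForm V N k} (hα : α.IsSmooth) (p : ℕ) : (C.bidegreePart p α).IsSmooth := by
  -- The smoothness of the connection is stated at `y₀` in the coordinates centred at `y₀`, so the
  -- form is tested only at the centre of each chart.
  refine DForm.isSmooth_of_contDiffAt fun y₀ => contDiffAt_of_apply fun v => ?_
  have h1 := (hα y₀).contDiffAt ((chartAt V y₀).open_target.mem_nhds (mem_chart_target V y₀))
  have hH := contDiffAt_coordHor (C := C) hκ y₀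
  have key : (fun z => (C.bidegreePart p α).inChart y₀ z v) =ᶠ[𝓝 (chartAt V y₀ y₀)] fun z =>
      ∑ S ∈ Finset.powersetCard p (Finset.univ : Finset (Fin k)), α.inChart y₀ z fun i =>
        if i ∈ S then C.coordHor y₀ z (v i) else v i - C.coordHor y₀ z (v i) := by
    filter_upwards [eventually_mem_source (W := W) (V := V) hκ.continuous y₀] with z hz
    refine (mixedPart_apply p (α ((chartAt V y₀).symm z)) _ _
      fun i => dMap V (chartAt V y₀).symm z (v i)).trans ?_
    refine Finset.sum_congr rfl fun S _ => ?_
    have h2 : ∀ i, (if i ∈ S then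
        (C.horProj ((chartAt V y₀).symm z) (dMap V (chartAt V y₀).symm z (v i)) : V) else
        C.verProj ((chartAt V y₀).symm z) (dMap V (chartAt V y₀).symm z (v i))) =
        dMap V (chartAt V y₀).symm z
          (if i ∈ S then C.coordHor y₀ z (v i) else v i - C.coordHor y₀ z (v i)) := by
      intro i
      have h3 := dMap_coordHor (C := C) hκ hz.1 hz.2 (v i)
      by_cases hi : i ∈ S
      · rw [if_pos hi, if_pos hi, h3]
      · rw [if_neg hi, if_neg hi, map_sub, h3]
        rfl
    exact α.apply_congr rfl (funext h2)
  refine ContDiffAt.congr_of_eventuallyEq (ContDiffAt.sum fun S _ => ?_) key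
  refine contDiffAt_alternating_apply (u := fun i z =>
    if i ∈ S then C.coordHor y₀ z (v i) else v i - C.coordHor y₀ z (v i)) h1 fun i => ?_
  have h3 := hH.clm_apply (contDiffAt_const (c := v i))
  by_cases hi : i ∈ S
  · simpa only [hi, if_true] using h3
  · simpa only [hi, if_false] using contDiffAt_const.sub h3

end EhresmannConnection

end ConnectionForms

/-- A volume form does not vanish on the coordinate basis of a chart. -/
theorem inChart_basis_ne_zero {m : ℕ} {M : Type*} [TopologicalSpace M] [ChartedSpace (R m) M]
    [IsManifold (𝓡 m) ∞ M] {η : DForm (R m) M m} {x₀ : M} (hη : ∀ x, η x ≠ 0) {x : M}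
    (hx : x ∈ (chartAt (R m) x₀).source) :
    η.inChart x₀ (chartAt (R m) x₀ x) (fun μ => EuclideanSpace.single μ 1) ≠ 0 := by
  intro h0
  let b := (EuclideanSpace.basisFun (Fin m) ℝ).toBasis
  have hb : ⇑b = fun μ => EuclideanSpace.single μ 1 := by
    funext μ
    simp [b]
  rw [← hb] at h0
  have h1 := (AlternatingMap.map_basis_eq_zero_iff b
    (η.inChart x₀ (chartAt (R m) x₀ x)).toAlternatingMap).1 h0
  refine hη x (ContinuousAlternatingMap.ext fun v => ?_)
  have h2 := DFunLike.congr_fun h1 fun i => mfderiv (𝓡 m) (𝓡 m) (chartAt (R m) x₀) x (v i)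
  refine Eq.trans ?_ h2
  exact η.apply_congr ((chartAt (R m) x₀).left_inv hx).symm
    (funext fun i => (dMap_chartAt_symm_mfderiv hx (v i)).symm)

/-! ### The decomposition and the 1-form `γ` on the total space. -/

namespace EhresmannConnection

open Filter Topology

variable {V : Type*} [NormedAddCommGroup V] [NormedSpace ℝ V]
  {N : Type*} [TopologicalSpace N] [ChartedSpace V N] [IsManifold 𝓘(ℝ, V) ∞ N]
  {m : ℕ} {M : Type*} [TopologicalSpace M] [ChartedSpace (R m) M] [IsManifold (𝓡 m) ∞ M]
  {κ : N → M} {C : EhresmannConnection (V := V) (W := R m) κ}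
  {η : DForm (R m) M m} {α : DForm V N (m + 1)}

variable (C) in
/-- The decomposition of a form vanishing on three vertical vectors. -/
theorem remainder_eq_bidegreePart (hm : 1 ≤ m)
    (h3 : ∀ (y : N) (v : Fin (m + 1) → TangentSpace 𝓘(ℝ, V) y) (i j k : Fin (m + 1)),
      i ≠ j → i ≠ k → j ≠ k →
      (∀ r ∈ ({i, j, k} : Set (Fin (m + 1))), mfderiv 𝓘(ℝ, V) (𝓡 m) κ y (v r) = 0) →
      α y v = 0) : C.remainder α = C.bidegreePart (m - 1) α :=
  funext fun y => sub_mixedPart_eq_mixedPart hm (α y) (l := C.lift y)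
    (d := mfderiv 𝓘(ℝ, V) (𝓡 m) κ y) (fun _ => rfl) (fun _ => rfl)
    (fun w => DFunLike.congr_fun (C.mfderiv_comp_lift y) w) (h3 y)

/-- The lift is a section of the differential of `κ`, so `horProj` and `verProj` are complementary
projections. -/
theorem bidegreePart_bidegreePart (p k : ℕ) (β : DForm V N k) :
    C.bidegreePart p (C.bidegreePart p β) = C.bidegreePart p β := by
  funext y
  have h (w : TangentSpace (𝓡 m) (κ y)) :
      mfderiv 𝓘(ℝ, V) (𝓡 m) κ y (C.lift y w) = w :=
    DFunLike.congr_fun (C.mfderiv_comp_lift y) w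
  have hA (v : TangentSpace 𝓘(ℝ, V) y) :
      C.horProj y v = C.lift y (mfderiv 𝓘(ℝ, V) (𝓡 m) κ y v) := rfl
  have hB (v : TangentSpace 𝓘(ℝ, V) y) : C.verProj y v = v - C.horProj y v := rfl
  refine mixedPart_mixedPart_self p (β y) ?_ ?_ ?_
  · intro v
    rw [hA, hA, h]
  · intro v
    rw [hB, hB, map_sub, hA, hA, h, sub_self, sub_zero]
  · intro v
    rw [hB, map_sub, hA, hA, h, sub_self]

variable [FiniteDimensional ℝ V]

theorem mul_gammaForm_apply (hη : ∀ x, η x ≠ 0) (y : N) (x : Fin m → R m) (u : Fin 1 → V) :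
    (η (κ y) : R m [⋀^Fin m]→L[ℝ] ℝ) x * (C.gammaForm η α y : V [⋀^Fin 1]→L[ℝ] ℝ) u =
      (α y : V [⋀^Fin (m + 1)]→L[ℝ] ℝ)
        (Fin.snoc (α := fun _ => V) (fun i => C.liftMap y (x i)) (u 0)) :=
  mul_contract_map_apply (α y) (C.lift y) (hη (κ y)) x u

/-- The 1-form `i(Y)α` is smooth. -/
theorem isSmooth_gammaForm (hκ : ContMDiff 𝓘(ℝ, V) (𝓡 m) ∞ κ) (hη : IsVolumeForm η)
    (hα : α.IsSmooth) : (C.gammaForm η α).IsSmooth := by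
  refine DForm.isSmooth_of_contDiffAt fun y₀ => contDiffAt_of_apply fun u => ?_
  have h1 := (hα y₀).contDiffAt ((chartAt V y₀).open_target.mem_nhds (mem_chart_target V y₀))
  have h2 := (hη.smooth (κ y₀)).contDiffAt
    ((chartAt (R m) (κ y₀)).open_target.mem_nhds (mem_chart_target (R m) (κ y₀)))
  have hy₀ : κ ((chartAt V y₀).symm (chartAt V y₀ y₀)) = κ y₀ := by
    rw [(chartAt V y₀).left_inv (mem_chart_source V y₀)]
  have h3 : ContDiffAt ℝ ∞ (chartAt (R m) (κ y₀) ∘ (κ ∘ (chartAt V y₀).symm))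
      (chartAt V y₀ y₀) := by
    refine contDiffAt_chartAt_comp
      (hκ.contMDiffAt.comp _ (contMDiffAt_chartAt_symm (mem_chart_target V y₀))) ?_
    rw [Function.comp_apply, hy₀]
    exact mem_chart_source (R m) _
  have h4 : ContDiffAt ℝ ∞ (fun z => η.inChart (κ y₀)
      ((chartAt (R m) (κ y₀) ∘ (κ ∘ (chartAt V y₀).symm)) z)
        fun μ => EuclideanSpace.single μ 1) (chartAt V y₀ y₀) := by
    refine contDiffAt_alternating_apply (u := fun μ _ => EuclideanSpace.single μ 1) ?_
      fun μ => contDiffAt_const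
    refine ContDiffAt.comp (g := η.inChart (κ y₀)) _ ?_ h3
    rw [Function.comp_apply, Function.comp_apply, hy₀]
    exact h2
  have hsrc := eventually_mem_source (W := R m) (V := V) hκ.continuous y₀
  -- `unitMultivector` uses the preferred chart at each point, which need not vary continuously. The
  -- frame of the one chart at `κ y₀` is used instead, at the price of dividing by the coefficient
  -- of `η` in it.
  have key : (fun z => (C.gammaForm η α).inChart y₀ z u) =ᶠ[𝓝 (chartAt V y₀ y₀)] fun z =>
      α.inChart y₀ z (Fin.snoc (α := fun _ => V)
        (fun μ => C.coordLift y₀ z (EuclideanSpace.single μ 1)) (u 0)) /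
      η.inChart (κ y₀) ((chartAt (R m) (κ y₀) ∘ (κ ∘ (chartAt V y₀).symm)) z)
        fun μ => EuclideanSpace.single μ 1 := by
    filter_upwards [hsrc] with z hz
    refine (eq_div_iff (inChart_basis_ne_zero hη.ne_zero hz.2)).2 ((mul_comm _ _).trans ?_)
    have h5 := mul_gammaForm_apply (C := C) (α := α) hη.ne_zero ((chartAt V y₀).symm z)
      (fun μ => dMap (R m) (chartAt (R m) (κ y₀)).symm
        (chartAt (R m) (κ y₀) (κ ((chartAt V y₀).symm z))) (EuclideanSpace.single μ 1))
      (fun i => dMap V (chartAt V y₀).symm z (u i))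
    refine Eq.trans (congrArg (· * _) ?_) (h5.trans ?_)
    · exact η.apply_congr ((chartAt (R m) (κ y₀)).left_inv hz.2) rfl
    · refine α.apply_congr rfl (funext fun i => ?_)
      refine Fin.lastCases ?_ (fun j => ?_) i
      · simp only [Fin.snoc_last]
        rfl
      · simp only [Fin.snoc_castSucc]
        exact (dMap_coordLift hz.1 hz.2 _).symm
  refine ContDiffAt.congr_of_eventuallyEq (ContDiffAt.div ?_ h4 ?_) key
  · have h6 := contDiffAt_alternating_apply (u := fun i z => Fin.snoc (α := fun _ => V)
        (fun μ => C.coordLift y₀ z (EuclideanSpace.single μ 1)) (u 0) i) h1 fun i => by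
      refine Fin.lastCases ?_ (fun j => ?_) i
      · simpa only [Fin.snoc_last] using contDiffAt_const
      · simpa only [Fin.snoc_castSucc] using
          (C.contDiffAt_coordLift y₀).clm_apply contDiffAt_const
    exact h6
  · rw [Function.comp_apply, Function.comp_apply, hy₀]
    exact inChart_basis_ne_zero hη.ne_zero (mem_chart_source (R m) _)

theorem wedge_gammaForm (hη : ∀ x, η x ≠ 0) (y : N) :
    wedge (η.pullback κ y).toAlternatingMap (C.gammaForm η α y).toAlternatingMap =
      (C.bidegreePart m α y).toAlternatingMap :=
  wedge_contract_eq_mixedPart (α y) (l := C.lift y) (d := mfderiv 𝓘(ℝ, V) (𝓡 m) κ y)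
    (fun _ => rfl) (fun _ => rfl) (hη (κ y))

end EhresmannConnection

end FieldTheory

end

/-! ### The decomposition of the Poincaré–Cartan form. -/

theorem mainTheorem9 {m n : ℕ} (hm : 1 ≤ m) {M E : Type*}
    [TopologicalSpace M] [ChartedSpace (FieldTheory.R m) M] [IsManifold (𝓡 m) ∞ M]
    [TopologicalSpace E] [ChartedSpace (FieldTheory.R (m + n)) E] [IsManifold (𝓡 (m + n)) ∞ E]
    (π : FieldTheory.FibredManifold m n M E)
    (η : FieldTheory.DForm (FieldTheory.R m) M m) (hη : FieldTheory.IsVolumeForm η)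
    (L : FieldTheory.Jet π → ℝ)
    (hL : ContMDiff 𝓘(ℝ, FieldTheory.JetModel m n) 𝓘(ℝ, ℝ) ∞ L)
    (nabla : FieldTheory.EhresmannConnection (V := FieldTheory.JetModel m n)
      (W := FieldTheory.R m) (FieldTheory.Jet.toBase (π := π))) :
    -- `γ = i(Y)Ω_ℒ` and `Ω_ℒ^∇` are differential forms
    (nabla.gammaForm η (FieldTheory.poincareCartanOmega η L)).IsSmooth ∧
    (nabla.remainder (FieldTheory.poincareCartanOmega η L)).IsSmooth ∧
    -- `Ω_ℒ = ω ∧ γ + Ω_ℒ^∇`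
    (∀ y : FieldTheory.Jet π,
      (FieldTheory.poincareCartanOmega η L y).toAlternatingMap =
        FieldTheory.wedge (FieldTheory.omegaForm η y).toAlternatingMap
          (nabla.gammaForm η (FieldTheory.poincareCartanOmega η L) y).toAlternatingMap +
        (nabla.remainder (FieldTheory.poincareCartanOmega η L) y).toAlternatingMap) ∧
    -- `Ω_ℒ^∇` has bidegree `(m - 1, 2)`
    nabla.HasBidegree (m - 1) 2 (nabla.remainder (FieldTheory.poincareCartanOmega η L)) ∧
    -- the equivalent form of the last condition: `Ω_ℒ` vanishes on three vertical vectors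
    (∀ (y : FieldTheory.Jet π)
      (v : Fin (m + 1) → TangentSpace 𝓘(ℝ, FieldTheory.JetModel m n) y) (i j k : Fin (m + 1)),
      i ≠ j → i ≠ k → j ≠ k →
      (∀ l ∈ ({i, j, k} : Set (Fin (m + 1))),
        mfderiv 𝓘(ℝ, FieldTheory.JetModel m n) (𝓡 m) (FieldTheory.Jet.toBase (π := π)) y (v l)
          = 0) →
      FieldTheory.poincareCartanOmega η L y v = 0) := by
  have hκ : ContMDiff 𝓘(ℝ, FieldTheory.JetModel m n) (𝓡 m) ∞
    (FieldTheory.Jet.toBase (π := π)) := FieldTheory.Jet.contMDiff_toBase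
  have hΩ : (FieldTheory.poincareCartanOmega η L).IsSmooth :=
    FieldTheory.isSmooth_poincareCartanOmega hη.smooth hL
  have h3 : ∀ (y : FieldTheory.Jet π)
      (v : Fin (m + 1) → TangentSpace 𝓘(ℝ, FieldTheory.JetModel m n) y) (i j k : Fin (m + 1)),
      i ≠ j → i ≠ k → j ≠ k →
      (∀ l ∈ ({i, j, k} : Set (Fin (m + 1))),
        mfderiv 𝓘(ℝ, FieldTheory.JetModel m n) (𝓡 m) (FieldTheory.Jet.toBase (π := π)) y (v l)
          = 0) →
      FieldTheory.poincareCartanOmega η L y v = 0 := fun y v i j k hij hik hjk hv =>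
    FieldTheory.poincareCartanOmega_eq_zero hη.smooth hL y v hij hik hjk hv
  have hr := nabla.remainder_eq_bidegreePart hm h3
  refine ⟨FieldTheory.EhresmannConnection.isSmooth_gammaForm hκ hη hΩ, ?_, fun y => ?_,
    ⟨by omega, ?_⟩, h3⟩
  · rw [hr]
    exact FieldTheory.EhresmannConnection.isSmooth_bidegreePart hκ hΩ (m - 1)
  -- Once `ω ∧ γ` is known to be the `(m, 1)` component, the identity is the definition of
  -- `remainder`.
  · refine Eq.trans ?_ (congrArg (· + _)
      (FieldTheory.EhresmannConnection.wedge_gammaForm hη.ne_zero y).symm)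
    ext v
    exact (add_sub_cancel _ _).symm
  · rw [hr]
    exact FieldTheory.EhresmannConnection.bidegreePart_bidegreePart (m - 1) (m + 1) _
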